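/- **Setting.** Digraph maps send each arrow to an arrow or to a single vertex. Let $(G,A)$ be a digraph pair ($A\subset G$ a not necessarily induced subdigraph) with basepoint $x_0\in A$, and $R$ a commutative ring. $J_m$ is the standard line digraph $0\to1\leftarrow2\to\cdots$ on $\{0,\dots,m\}$, $\partial J_m=\{0,m\}$ (no arrows), and $J_m^{\Box n}=J_{m_1}\Box\cdots\Box J_{m_n}$. Write $\partial J_m^{\Box n}$ for the boundary of this grid and $\overline J{}^{\,\Box(n-1)}_m=(\{m_1\}\Box J^{\Box(n-1)})\cup(J_{m_1}\Box\partial J^{\Box(n-1)})$. For $n\ge1$, $\bar\pi_n(G,A)$ is the set of $F$-homotopy classes of maps of triples $f:(J_m^{\Box n},\partial J_m^{\Box n},\overline J{}^{\,\Box(n-1)}_m)\to(G,A,x_0)$ of all sizes $m$: a subdivision of $f$ is a composite $f\circ h$ with a product $h$ of order preserving digraph maps $J_{M_k}\to J_{m_k}$ with $0\mapsto0$, $M_k\mapsto m_k$, and $F$-homotopy is the equivalence relation generated by $f\simeq_1g$, meaning that some subdivisions $\bar f,\bar g$ of $f,g$ on a common grid $J_M^{\Box n}$ are the two ends of a map of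 triples $(J_M^{\Box n},\partial J_M^{\Box n},\overline J{}^{\,\Box(n-1)}_M)\Box J_1\to(G,A,x_0)$. Put $\bar\pi_n(A)=\bar\pi_n(A,\{x_0\})$, and let $\partial_{n+1}:\bar\pi_{n+1}(G,A)\to\bar\pi_n(A)$ be $[\gamma]\mapsto[\gamma(0,\cdot)]$. Let $C^c_n(G)$ be the free $R$-module on the digraph maps $c:J_1^{\Box n}\to G$ modulo the degenerate ones (those that factor through omitting a coordinate), with $\partial^c c=\sum_{i=1}^n(-1)^i(c\circ F_{i,0}-c\circ F_{i,1})$, where $F_{i,t}$ inserts $t$ as $i$-th coordinate. $H^c_n(G)$ and $H^c_n(G,A)$ are the homology of $C^c_*(G)$ and of $C^c_*(G)/C^c_*(A)$, and $\xi^c_{n+1}:H^c_{n+1}(G,A)\to H^c_n(A)$ is the connecting homomorphism $[c]\mapsto[\partial^c c]$. For a triple grid map $f$ put $$h_n(f)=\sum_{0\le i_k\le m_k-1}(-1)^{T(\sigma_i)}\,f\circ\sigma_i ,$$ where $\sigma_i$ is the coordinatewise isomorphism of $J_1^{\Box n}$ onto the unit cube of $J_m^{\Box n}$ with smallest vertex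 $i=(i_1,\dots,i_n)$ and $T(\sigma_i)$ is the number of coordinate axes reversed by $\sigma_i$ (the number of odd $i_k$). **Theorem.** For $n\ge1$: 1. $h_n(f\circ h)=h_n(f)$ in $C^c_n(G)/C^c_n(A)$ for every subdivision $f\circ h$ of a triple grid map $f$. 2. $h_n(f)$ is a relative cycle whose homology class depends only on the $F$-homotopy class of $f$, so there is a well defined map of sets $H_n:\bar\pi_n(G,A)\to H^c_n(G,A)$, $[f]\mapsto[h_n(f)]$; in the same way there is a well defined map $H_n:\bar\pi_n(A)\to H^c_n(A)$. 3. If $n\ge2$, concatenation in the second coordinate (of grid maps, the first having even length in that coordinate, after extending both by $x_0$ to a common size in the other coordinates) makes $\bar\pi_n(G,A)$ a group, and $H_n$ is a group homomorphism. 4. For every based map of pairs $\varphi:(G,A,x_0)\to(H,B,y_0)$, $\ H^c_n(\varphi)\circ H_n=H_n\circ\bar\pi_n(\varphi)$. 5. The Hurewicz maps commute with the boundary maps up to the sign $-1$ given by the above conventions: $\xi^c_{n+1}\circ H_{n+1}=-\,H_n\circ\partial_{n+1}:\bar\pi_{n+1}(G,A)\to H^c_n(A)$. -/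

import Mathlib

namespace DigraphHurewicz

noncomputable section

/-! ### Digraphs, subdigraphs, box products

A digraph is Mathlib's `Digraph`.  Loops are irrelevant: everything below only depends on the
relation "there is an arrow `v → w`, or `v = w`". -/

/-- Digraph maps: every arrow is sent to an arrow or to a single vertex. -/
def IsMap {V W : Type*} (G : Digraph V) (H : Digraph W) (f : V → W) : Prop :=
  ∀ ⦃v w : V⦄, G.Adj v w → H.Adj (f v) (f w) ∨ f v = f w

/-- A (not necessarily induced) subdigraph. -/
structure Subdigraph {V : Type*} (G : Digraph V) where
  verts : Set V
  Adj : V → V → Prop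
  adj_sub : ∀ ⦃v w⦄, Adj v w → G.Adj v w
  left_mem : ∀ ⦃v w⦄, Adj v w → v ∈ verts
  right_mem : ∀ ⦃v w⦄, Adj v w → w ∈ verts

/-- A subdigraph as a digraph in its own right. -/
def Subdigraph.coe {V : Type*} {G : Digraph V} (A : Subdigraph G) : Digraph A.verts where
  Adj a b := A.Adj a b

/-- The discrete subdigraph consisting of one vertex. -/
def Subdigraph.point {V : Type*} (G : Digraph V) (x : V) : Subdigraph G where
  verts := {x}
  Adj _ _ := False
  adj_sub _ _ h := h.elim
  left_mem _ _ h := h.elim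
  right_mem _ _ h := h.elim

/-- `f(S) ⊂ T`: vertices of `S` go to vertices of `T`, and every arrow of `S` goes to an arrow of
`T` or to a single vertex. -/
def MapsInto {V W : Type*} {G : Digraph V} {H : Digraph W} (f : V → W)
    (S : Subdigraph G) (T : Subdigraph H) : Prop :=
  (∀ v ∈ S.verts, f v ∈ T.verts) ∧
    ∀ ⦃v w⦄, S.Adj v w → T.Adj (f v) (f w) ∨ f v = f w

/-- The box product of two digraphs. -/
def boxProd {V W : Type*} (G : Digraph V) (H : Digraph W) : Digraph (V × W) where
  Adj p q := (p.1 = q.1 ∧ H.Adj p.2 q.2) ∨ (G.Adj p.1 q.1 ∧ p.2 = q.2)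

/-- The subdigraph `S □ H` of `G □ H`, for a subdigraph `S` of `G`. -/
def Subdigraph.boxRight {V W : Type*} {G : Digraph V} (S : Subdigraph G) (H : Digraph W) :
    Subdigraph (boxProd G H) where
  verts := {p | p.1 ∈ S.verts}
  Adj p q := (p.1 = q.1 ∧ p.1 ∈ S.verts ∧ H.Adj p.2 q.2) ∨ (S.Adj p.1 q.1 ∧ p.2 = q.2)
  adj_sub p q h := by
    rcases h with ⟨h1, _, h2⟩ | ⟨h1, h2⟩
    · exact Or.inl ⟨h1, h2⟩
    · exact Or.inr ⟨S.adj_sub h1, h2⟩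
  left_mem p q h := by
    rcases h with ⟨_, h1, _⟩ | ⟨h1, _⟩
    · exact h1
    · exact S.left_mem h1
  right_mem p q h := by
    rcases h with ⟨h0, h1, _⟩ | ⟨h1, _⟩
    · exact (congrArg (· ∈ S.verts) h0).mp h1
    · exact S.right_mem h1

/-- The box product of a finite family of digraphs. -/
def boxPi {n : ℕ} {V : Fin n → Type*} (G : ∀ k, Digraph (V k)) : Digraph (∀ k, V k) where
  Adj v w := ∃ k, (G k).Adj (v k) (w k) ∧ ∀ j, j ≠ k → v j = w j

/-! ### Standard line digraphs and grids -/

/-- The arrows of the standard (infinite) line digraph `0 → 1 ← 2 → 3 ← ⋯`. -/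
def LineAdj (a b : ℕ) : Prop := (b = a + 1 ∧ Even a) ∨ (a = b + 1 ∧ Odd b)

/-- The standard line digraph `J_m` on `{0, …, m}`. -/
def line (m : ℕ) : Digraph (Fin (m + 1)) where
  Adj a b := LineAdj a b

/-- The vertices of the grid `J_{m_1} □ ⋯ □ J_{m_n}`. -/
abbrev GridVertex {n : ℕ} (m : Fin n → ℕ) : Type := ∀ k, Fin (m k + 1)

/-- The grid `J_{m_1} □ ⋯ □ J_{m_n}`. -/
def grid {n : ℕ} (m : Fin n → ℕ) : Digraph (GridVertex m) := boxPi fun k => line (m k)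

/-- The vertex `a` belongs to `∂J_m = {0, m}`. -/
def IsEnd {m : ℕ} (a : Fin (m + 1)) : Prop := a = 0 ∨ a = Fin.last m

/-- The boundary of the grid: the union over `k` of the box products in which the `k`-th factor
`J_{m_k}` is replaced by the discrete digraph `∂J_{m_k}`. -/
def gridBoundary {n : ℕ} (m : Fin n → ℕ) : Subdigraph (grid m) where
  verts := {v | ∃ k, IsEnd (v k)}
  Adj v w := (grid m).Adj v w ∧ ∃ k, IsEnd (v k) ∧ v k = w k
  adj_sub _ _ h := h.1
  left_mem _ _ h := by
    obtain ⟨_, k, hk, _⟩ := h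
    exact ⟨k, hk⟩
  right_mem _ _ h := by
    obtain ⟨_, k, hk, e⟩ := h
    exact ⟨k, e ▸ hk⟩

/-- The vertices of `J̄ = m_1 □ J^{n-1} ∪ J_{m_1} □ ∂J^{n-1}`, the boundary of the grid with the
interior of the face `v_1 = 0` removed. (The coordinates are numbered from `0` in `Fin n`.) -/
def gridHorn {n : ℕ} [NeZero n] (m : Fin n → ℕ) : Set (GridVertex m) :=
  {v | v 0 = Fin.last (m 0) ∨ ∃ k, k ≠ 0 ∧ IsEnd (v k)}

/-! ### Based digraph pairs and triple grid maps -/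

/-- A digraph pair `(G, A)` with basepoint `x₀ ∈ A`. -/
structure BasedPair (V : Type*) where
  G : Digraph V
  A : Subdigraph G
  x₀ : V
  mem : x₀ ∈ A.verts

/-- Based maps of pairs `(G, A, x₀) → (H, B, y₀)`. -/
structure BasedPair.Hom {V W : Type*} (P : BasedPair V) (Q : BasedPair W) where
  toFun : V → W
  isMap : IsMap P.G Q.G toFun
  mapsInto : MapsInto toFun P.A Q.A
  map_base : toFun P.x₀ = Q.x₀

/-- The pair `(A, x₀)`. -/
def BasedPair.sub {V : Type*} (P : BasedPair V) : BasedPair P.A.verts where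
  G := P.A.coe
  A := Subdigraph.point P.A.coe ⟨P.x₀, P.mem⟩
  x₀ := ⟨P.x₀, P.mem⟩
  mem := rfl

/-- Triple grid maps `(J_m^{□n}, ∂J_m^{□n}, J̄_m^{□(n-1)}) → (G, A, x₀)`, for `n ≥ 1`. -/
structure GridMap {V : Type*} (P : BasedPair V) {n : ℕ} [NeZero n] (m : Fin n → ℕ) where
  toFun : GridVertex m → V
  isMap : IsMap (grid m) P.G toFun
  boundary : MapsInto toFun (gridBoundary m) P.A
  horn : ∀ v ∈ gridHorn m, toFun v = P.x₀

/-- Shrinking maps `J_M → J_m`. -/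
structure IsShrinking {M m : ℕ} (h : Fin (M + 1) → Fin (m + 1)) : Prop where
  isMap : IsMap (line M) (line m) h
  map_zero : h 0 = 0
  map_last : h (Fin.last M) = Fin.last m
  monotone : Monotone h

/-- `n`-dimensional shrinking maps: box products of shrinking maps. -/
structure Shrinking {n : ℕ} (M m : Fin n → ℕ) where
  toFun : ∀ k, Fin (M k + 1) → Fin (m k + 1)
  shrinks : ∀ k, IsShrinking (toFun k)

theorem Shrinking.isEnd {n : ℕ} {M m : Fin n → ℕ} (h : Shrinking M m) {k : Fin n}
    {a : Fin (M k + 1)} (ha : IsEnd a) : IsEnd (h.toFun k a) := by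
  rcases ha with rfl | rfl
  · exact Or.inl (h.shrinks k).map_zero
  · exact Or.inr (h.shrinks k).map_last

theorem Shrinking.adj {n : ℕ} {M m : Fin n → ℕ} (h : Shrinking M m) :
    IsMap (grid M) (grid m) fun v k => h.toFun k (v k) := by
  rintro v w ⟨k, hk, hne⟩
  rcases (h.shrinks k).isMap hk with h1 | h1
  · exact Or.inl ⟨k, h1, fun j hj => by simp only [hne j hj]⟩
  · refine Or.inr (funext fun j => ?_)
    by_cases hj : j = k
    · subst hj; exact h1
    · simp only [hne j hj]

/-- The subdivision `f ∘ h` of a triple grid map `f` along a shrinking map `h`. -/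
def GridMap.subdivide {V : Type*} {P : BasedPair V} {n : ℕ} [NeZero n] {m M : Fin n → ℕ}
    (f : GridMap P m) (h : Shrinking M m) : GridMap P M where
  toFun v := f.toFun fun k => h.toFun k (v k)
  isMap v w hvw := by
    rcases h.adj hvw with h1 | h1
    · exact f.isMap h1
    · exact Or.inr (congrArg f.toFun h1)
  boundary := by
    refine ⟨fun v hv => ?_, fun v w hvw => ?_⟩
    · obtain ⟨k, hk⟩ := hv
      exact f.boundary.1 _ ⟨k, h.isEnd hk⟩
    · obtain ⟨ha, k, hk, e⟩ := hvw
      rcases h.adj ha with h1 | h1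
      · exact f.boundary.2 ⟨h1, k, h.isEnd hk, by simp only [e]⟩
      · exact Or.inr (congrArg f.toFun h1)
  horn v hv := by
    apply f.horn
    rcases hv with hv | ⟨k, hk, hv⟩
    · exact Or.inl (by simp only [hv]; exact (h.shrinks 0).map_last)
    · exact Or.inr ⟨k, hk, h.isEnd hv⟩

/-! ### `F`-homotopy and the relative homotopy sets -/

/-- `f ⇉ g` for triple grid maps on the same grid: there is a map of triples
`F : (J_M^{□n}, ∂J_M^{□n}, J̄_M^{□(n-1)}) □ J_1 → (G, A, x₀)` from `f` to `g`. -/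
def DirectHomotopic {V : Type*} {P : BasedPair V} {n : ℕ} [NeZero n] {M : Fin n → ℕ}
    (f g : GridMap P M) : Prop :=
  ∃ F : GridVertex M × Fin 2 → V,
    IsMap (boxProd (grid M) (line 1)) P.G F ∧
    MapsInto F ((gridBoundary M).boxRight (line 1)) P.A ∧
    (∀ v ∈ gridHorn M, ∀ t, F (v, t) = P.x₀) ∧
    (∀ v, F (v, 0) = f.toFun v) ∧ (∀ v, F (v, 1) = g.toFun v)

/-- Triple grid maps of dimension `n` of arbitrary sizes. -/
abbrev AnyGridMap {V : Type*} (P : BasedPair V) (n : ℕ) [NeZero n] :=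
  Σ m : Fin n → ℕ, GridMap P m

/-- One-step `F`-homotopy rel `A`: suitable subdivisions are directly homotopic. -/
def OneStep {V : Type*} (P : BasedPair V) (n : ℕ) [NeZero n] (f g : AnyGridMap P n) : Prop :=
  ∃ (M : Fin n → ℕ) (h : Shrinking M f.1) (h' : Shrinking M g.1),
    DirectHomotopic (f.2.subdivide h) (g.2.subdivide h')

/-- `F`-homotopy: a finite sequence of one-step and inverse one-step `F`-homotopies. -/
def FHomotopic {V : Type*} (P : BasedPair V) (n : ℕ) [NeZero n] :
    AnyGridMap P n → AnyGridMap P n → Prop :=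
  Relation.EqvGen (OneStep P n)

/-- The set `π̄_n(G, A)` of `F`-homotopy classes of triple grid maps, `n ≥ 1`. Extending a grid map
to a larger grid by the constant `x₀` is a subdivision, so the identifications of the direct limit
over the grid sizes are among the `F`-homotopies. -/
def HomotopySet {V : Type*} (P : BasedPair V) (n : ℕ) [NeZero n] : Type _ :=
  Quot (FHomotopic P n)

/-- The class `[f]`. -/
def HomotopySet.mk {V : Type*} {P : BasedPair V} {n : ℕ} [NeZero n] {m : Fin n → ℕ}
    (f : GridMap P m) : HomotopySet P n :=
  Quot.mk _ ⟨m, f⟩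

/-- Operations on grid maps compatible with one-step `F`-homotopy pass to homotopy sets. -/
def HomotopySet.lift {V W : Type*} {P : BasedPair V} {Q : BasedPair W} {n k : ℕ} [NeZero n]
    [NeZero k] (T : AnyGridMap P n → AnyGridMap Q k)
    (hT : ∀ f g, OneStep P n f g → OneStep Q k (T f) (T g)) :
    HomotopySet P n → HomotopySet Q k :=
  Quot.map T fun f g h => by
    induction h with
    | rel f g h => exact .rel _ _ (hT f g h)
    | refl f => exact .refl _
    | symm f g _ ih => exact .symm _ _ ih
    | trans f g k _ _ ih₁ ih₂ => exact .trans _ _ _ ih₁ ih₂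

/-- The composite of a triple grid map with a based map of pairs. -/
def GridMap.comp {V W : Type*} {P : BasedPair V} {Q : BasedPair W} (φ : P.Hom Q) {n : ℕ} [NeZero n]
    {m : Fin n → ℕ} (f : GridMap P m) : GridMap Q m where
  toFun v := φ.toFun (f.toFun v)
  isMap v w h := by
    rcases f.isMap h with h1 | h1
    · exact φ.isMap h1
    · exact Or.inr (congrArg φ.toFun h1)
  boundary := by
    refine ⟨fun v hv => φ.mapsInto.1 _ (f.boundary.1 v hv), fun v w h => ?_⟩
    rcases f.boundary.2 h with h1 | h1
    · exact φ.mapsInto.2 h1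
    · exact Or.inr (congrArg φ.toFun h1)
  horn v hv := by simp only [f.horn v hv, φ.map_base]

/-- The induced map `π̄_n(G, A) → π̄_n(H, B)`, `[f] ↦ [φ ∘ f]`. -/
def HomotopySet.map {V W : Type*} {P : BasedPair V} {Q : BasedPair W} (φ : P.Hom Q) (n : ℕ)
    [NeZero n] : HomotopySet P n → HomotopySet Q n :=
  HomotopySet.lift (fun f => ⟨f.1, f.2.comp φ⟩) <| by
    rintro f g ⟨M, h, h', F, h1, h2, h3, h4, h5⟩
    refine ⟨M, h, h', fun p => φ.toFun (F p), ?_, ⟨?_, ?_⟩, ?_, ?_, ?_⟩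
    · intro p q hpq
      rcases h1 hpq with e | e
      · exact φ.isMap e
      · exact Or.inr (congrArg φ.toFun e)
    · exact fun p hp => φ.mapsInto.1 _ (h2.1 p hp)
    · intro p q hpq
      rcases h2.2 hpq with e | e
      · exact φ.mapsInto.2 e
      · exact Or.inr (congrArg φ.toFun e)
    · intro v hv t
      simp only [h3 v hv t, φ.map_base]
    · exact fun v => congrArg φ.toFun (h4 v)
    · exact fun v => congrArg φ.toFun (h5 v)

/-- The restriction `a ↦ γ(0, a)` of a triple grid map `γ` of dimension `n + 2` to the face
on which the first coordinate is `0`: a grid map of pairs `(J^{□(n+1)}, ∂J^{□(n+1)}) → (A, x₀)`. -/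
def GridMap.face {V : Type*} {P : BasedPair V} {n : ℕ} {m : Fin (n + 2) → ℕ} (γ : GridMap P m) :
    GridMap P.sub (n := n + 1) fun k => m k.succ where
  toFun a := ⟨γ.toFun (Fin.cons 0 a : GridVertex m), γ.boundary.1 _ ⟨0, Or.inl rfl⟩⟩
  isMap a b h := by
    obtain ⟨k, hk, hne⟩ := h
    have h2 : (gridBoundary m).Adj (Fin.cons 0 a) (Fin.cons 0 b) := by
      refine ⟨⟨k.succ, hk, fun j => ?_⟩, 0, Or.inl rfl, rfl⟩
      refine Fin.cases (fun _ => rfl) (fun j hj => ?_) j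
      exact hne j fun e => hj (congrArg Fin.succ e)
    rcases γ.boundary.2 h2 with h3 | h3
    · exact Or.inl h3
    · exact Or.inr (Subtype.ext h3)
  boundary := by
    have key : ∀ a : GridVertex (fun k : Fin (n + 1) => m k.succ), (∃ k, IsEnd (a k)) →
        γ.toFun (Fin.cons 0 a : GridVertex m) = P.x₀ := fun a ⟨k, hk⟩ =>
      γ.horn _ (Or.inr ⟨k.succ, Fin.succ_ne_zero k, hk⟩)
    refine ⟨fun a ha => Subtype.ext (key a ha), fun a b h => Or.inr (Subtype.ext ?_)⟩
    exact (key a ((gridBoundary _).left_mem h)).trans (key b ((gridBoundary _).right_mem h)).symm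
  horn a ha := by
    refine Subtype.ext (γ.horn _ (Or.inr ?_))
    rcases ha with ha | ⟨k, _, hk⟩
    · exact ⟨(0 : Fin (n + 1)).succ, Fin.succ_ne_zero 0, Or.inr ha⟩
    · exact ⟨k.succ, Fin.succ_ne_zero k, hk⟩

/-- The boundary map `∂ : π̄_{n+2}(G, A) → π̄_{n+1}(A)`, `[γ] ↦ [γ(0, ·)]`. -/
def HomotopySet.boundary {V : Type*} (P : BasedPair V) (n : ℕ) :
    HomotopySet P (n + 2) → HomotopySet P.sub (n + 1) :=
  HomotopySet.lift (fun f => ⟨fun k => f.1 k.succ, f.2.face⟩) <| by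
    rintro ⟨m, f⟩ ⟨l, g⟩ ⟨M, h, h', F, h1, h2, h3, h4, h5⟩
    have key : ∀ (a : GridVertex (fun k : Fin (n + 1) => M k.succ)) (t : Fin 2),
        (∃ k, IsEnd (a k)) → F ((Fin.cons 0 a : GridVertex M), t) = P.x₀ := fun a t ⟨k, hk⟩ =>
      h3 _ (Or.inr ⟨k.succ, Fin.succ_ne_zero k, hk⟩) t
    refine ⟨fun k => M k.succ, ⟨fun k => h.toFun k.succ, fun k => h.shrinks k.succ⟩,
      ⟨fun k => h'.toFun k.succ, fun k => h'.shrinks k.succ⟩,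
      fun p => ⟨F ((Fin.cons 0 p.1 : GridVertex M), p.2), h2.1 _ ⟨0, Or.inl rfl⟩⟩,
      ?_, ⟨?_, ?_⟩, ?_, ?_, ?_⟩
    · rintro ⟨a, s⟩ ⟨b, t⟩ hab
      have h6 : ((gridBoundary M).boxRight (line 1)).Adj ((Fin.cons 0 a : GridVertex M), s)
          ((Fin.cons 0 b : GridVertex M), t) := by
        rcases hab with ⟨e, hst⟩ | ⟨⟨k, hk, hne⟩, e⟩
        · exact Or.inl ⟨congrArg (fun a => (Fin.cons 0 a : GridVertex M)) e,
            ⟨0, Or.inl rfl⟩, hst⟩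
        · refine Or.inr ⟨⟨⟨k.succ, hk, fun j => ?_⟩, 0, Or.inl rfl, rfl⟩, e⟩
          refine Fin.cases (fun _ => rfl) (fun j hj => ?_) j
          exact hne j fun e => hj (congrArg Fin.succ e)
      rcases h2.2 h6 with h7 | h7
      · exact Or.inl h7
      · exact Or.inr (Subtype.ext h7)
    · exact fun p hp => Subtype.ext (key p.1 p.2 hp)
    · intro p q hpq
      refine Or.inr (Subtype.ext ?_)
      exact (key p.1 p.2 (Subdigraph.left_mem _ hpq)).trans
        (key q.1 q.2 (Subdigraph.right_mem _ hpq)).symm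
    · intro v hv t
      refine Subtype.ext (key v t ?_)
      rcases hv with hv | ⟨k, _, hk⟩
      · exact ⟨0, Or.inr hv⟩
      · exact ⟨k, hk⟩
    · intro a
      refine Subtype.ext ((h4 _).trans ?_)
      refine congrArg f.toFun (funext fun j => ?_)
      exact Fin.cases (h.shrinks 0).map_zero (fun j => rfl) j
    · intro a
      refine Subtype.ext ((h5 _).trans ?_)
      refine congrArg g.toFun (funext fun j => ?_)
      exact Fin.cases (h'.shrinks 0).map_zero (fun j => rfl) j

/-! ### Concatenation -/

/-- The extension of a triple grid map by the constant `x₀` outside of its grid. -/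
def GridMap.extend {V : Type*} {P : BasedPair V} {n : ℕ} [NeZero n] {m : Fin n → ℕ}
    (f : GridMap P m) (v : Fin n → ℕ) : V :=
  open Classical in
  if h : ∀ k, v k ≤ m k then f.toFun fun k => ⟨v k, Nat.lt_succ_of_le (h k)⟩ else P.x₀

theorem GridMap.extend_horn {V : Type*} {P : BasedPair V} {n : ℕ} [NeZero n] {m : Fin n → ℕ}
    (f : GridMap P m) (v : Fin n → ℕ) (hv : (∃ k, m k ≤ v k) ∨ ∃ k, k ≠ 0 ∧ v k = 0) :
    f.extend v = P.x₀ := by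
  unfold GridMap.extend
  split_ifs with h
  · apply f.horn
    rcases hv with ⟨k, hk⟩ | ⟨k, hk, hv⟩
    · have e : v k = m k := le_antisymm (h k) hk
      by_cases h0 : k = 0
      · subst h0; exact Or.inl (Fin.ext e)
      · exact Or.inr ⟨k, h0, Or.inr (Fin.ext e)⟩
    · exact Or.inr ⟨k, hk, Or.inl (Fin.ext hv)⟩
  · rfl

theorem GridMap.extend_of_not_le {V : Type*} {P : BasedPair V} {n : ℕ} [NeZero n] {m : Fin n → ℕ}
    (f : GridMap P m) (v w : Fin n → ℕ) (k : Fin n) (hk : LineAdj (v k) (w k))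
    (hne : ∀ j, j ≠ k → v j = w j) (hvw : ¬ ((∀ j, v j ≤ m j) ∧ ∀ j, w j ≤ m j)) :
    f.extend v = f.extend w := by
  have step : v k ≤ w k + 1 ∧ w k ≤ v k + 1 := by
    rcases hk with ⟨h, _⟩ | ⟨h, _⟩ <;> omega
  have : (∃ j, m j ≤ v j) ∧ ∃ j, m j ≤ w j := by
    rw [not_and_or, not_forall, not_forall] at hvw
    rcases hvw with ⟨j, hj⟩ | ⟨j, hj⟩
    · refine ⟨⟨j, by omega⟩, j, ?_⟩
      by_cases e : j = k
      · subst e; omega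
      · rw [← hne j e]; omega
    · refine ⟨⟨j, ?_⟩, j, by omega⟩
      by_cases e : j = k
      · subst e; omega
      · rw [hne j e]; omega
  rw [f.extend_horn v (Or.inl this.1), f.extend_horn w (Or.inl this.2)]

theorem GridMap.extend_isMap {V : Type*} {P : BasedPair V} {n : ℕ} [NeZero n] {m : Fin n → ℕ}
    (f : GridMap P m) (v w : Fin n → ℕ) (k : Fin n) (hk : LineAdj (v k) (w k))
    (hne : ∀ j, j ≠ k → v j = w j) :
    P.G.Adj (f.extend v) (f.extend w) ∨ f.extend v = f.extend w := by
  by_cases hvw : (∀ j, v j ≤ m j) ∧ ∀ j, w j ≤ m j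
  · unfold GridMap.extend
    rw [dif_pos hvw.1, dif_pos hvw.2]
    exact f.isMap ⟨k, hk, fun j hj => Fin.ext (hne j hj)⟩
  · exact Or.inr (f.extend_of_not_le v w k hk hne hvw)

theorem GridMap.extend_mem {V : Type*} {P : BasedPair V} {n : ℕ} [NeZero n] {m : Fin n → ℕ}
    (f : GridMap P m) (v : Fin n → ℕ) (hv : v 0 = 0) : f.extend v ∈ P.A.verts := by
  unfold GridMap.extend
  split_ifs with h
  · exact f.boundary.1 _ ⟨0, Or.inl (Fin.ext hv)⟩
  · exact P.mem

theorem GridMap.extend_mapsInto {V : Type*} {P : BasedPair V} {n : ℕ} [NeZero n] {m : Fin n → ℕ}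
    (f : GridMap P m) (v w : Fin n → ℕ) (hv : v 0 = 0) (hw : w 0 = 0) (k : Fin n)
    (hk : LineAdj (v k) (w k)) (hne : ∀ j, j ≠ k → v j = w j) :
    P.A.Adj (f.extend v) (f.extend w) ∨ f.extend v = f.extend w := by
  by_cases hvw : (∀ j, v j ≤ m j) ∧ ∀ j, w j ≤ m j
  · unfold GridMap.extend
    rw [dif_pos hvw.1, dif_pos hvw.2]
    exact f.boundary.2 ⟨⟨k, hk, fun j hj => Fin.ext (hne j hj)⟩, 0, Or.inl (Fin.ext hv),
      Fin.ext (hv.trans hw.symm)⟩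
  · exact Or.inr (f.extend_of_not_le v w k hk hne hvw)

/-- The size of a concatenation along the second coordinate. -/
def concatSize {n : ℕ} (m l : Fin (n + 2) → ℕ) : Fin (n + 2) → ℕ :=
  fun k => if k = 1 then m k + l k else max (m k) (l k)

/-- Translation by `-c` in the second coordinate. -/
def shift {n : ℕ} (c : ℕ) (v : Fin (n + 2) → ℕ) : Fin (n + 2) → ℕ :=
  fun k => if k = 1 then v k - c else v k

/-- The concatenation of the extended maps `f` and `g` along the second coordinate. -/
def concatFun {V : Type*} {P : BasedPair V} {n : ℕ} {m l : Fin (n + 2) → ℕ}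
    (f : GridMap P m) (g : GridMap P l) (v : Fin (n + 2) → ℕ) : V :=
  if v 1 ≤ m 1 then f.extend v else g.extend (shift (m 1) v)

theorem concatFun_of_ge {V : Type*} {P : BasedPair V} {n : ℕ} {m l : Fin (n + 2) → ℕ}
    (f : GridMap P m) (g : GridMap P l) (v : Fin (n + 2) → ℕ) (hv : m 1 ≤ v 1) :
    concatFun f g v = g.extend (shift (m 1) v) := by
  unfold concatFun
  split_ifs with h
  · rw [f.extend_horn v (Or.inl ⟨1, hv⟩), g.extend_horn]
    refine Or.inr ⟨1, by simp, ?_⟩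
    simp only [shift, if_true]
    omega
  · rfl

theorem shift_adj {n : ℕ} {c : ℕ} (hc : Even c) {v w : Fin (n + 2) → ℕ} (hv : c ≤ v 1)
    (hw : c ≤ w 1) {k : Fin (n + 2)} (hk : LineAdj (v k) (w k)) (hne : ∀ j, j ≠ k → v j = w j) :
    LineAdj (shift c v k) (shift c w k) ∧ ∀ j, j ≠ k → shift c v j = shift c w j := by
  refine ⟨?_, fun j hj => by simp only [shift, hne j hj]⟩
  by_cases h1 : k = 1
  · subst h1
    simp only [shift, if_true]
    rcases hk with ⟨h, e⟩ | ⟨h, e⟩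
    · exact Or.inl ⟨by omega, (Nat.even_sub hv).2 (by simp [e, hc])⟩
    · exact Or.inr ⟨by omega, (Nat.odd_sub hw).2 (by simp [e, hc])⟩
  · simpa only [shift, if_neg h1] using hk

/-- An arrow of the infinite grid does not cross the hyperplane `v_2 = c`. -/
theorem le_or_ge {n : ℕ} (c : ℕ) {v w : Fin (n + 2) → ℕ} {k : Fin (n + 2)}
    (hk : LineAdj (v k) (w k)) (hne : ∀ j, j ≠ k → v j = w j) :
    (v 1 ≤ c ∧ w 1 ≤ c) ∨ (c ≤ v 1 ∧ c ≤ w 1) := by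
  by_cases h1 : (1 : Fin (n + 2)) = k
  · subst h1
    rcases hk with ⟨h, _⟩ | ⟨h, _⟩ <;> omega
  · have := hne 1 h1
    omega

theorem concatFun_horn {V : Type*} {P : BasedPair V} {n : ℕ} {m l : Fin (n + 2) → ℕ}
    (f : GridMap P m) (g : GridMap P l) (v : Fin (n + 2) → ℕ)
    (hv : (∃ k, concatSize m l k ≤ v k) ∨ ∃ k, k ≠ 0 ∧ v k = 0) : concatFun f g v = P.x₀ := by
  rcases le_total (v 1) (m 1) with h | h
  · unfold concatFun
    rw [if_pos h]
    apply f.extend_horn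
    rcases hv with ⟨k, hk⟩ | hv
    · refine Or.inl ⟨k, le_trans ?_ hk⟩
      unfold concatSize
      split_ifs
      · omega
      · exact le_max_left _ _
    · exact Or.inr hv
  · rw [concatFun_of_ge f g v h]
    apply g.extend_horn
    rcases hv with ⟨k, hk⟩ | ⟨k, hk, e⟩
    · refine Or.inl ⟨k, ?_⟩
      unfold concatSize at hk
      unfold shift
      split_ifs at hk ⊢ with h1
      · subst h1; omega
      · exact (le_max_right _ _).trans hk
    · refine Or.inr ⟨k, hk, ?_⟩
      unfold shift
      split_ifs <;> omega

theorem concatFun_isMap {V : Type*} {P : BasedPair V} {n : ℕ} {m l : Fin (n + 2) → ℕ}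
    (f : GridMap P m) (g : GridMap P l) (hm : Even (m 1)) (v w : Fin (n + 2) → ℕ) (k : Fin (n + 2))
    (hk : LineAdj (v k) (w k)) (hne : ∀ j, j ≠ k → v j = w j) :
    P.G.Adj (concatFun f g v) (concatFun f g w) ∨ concatFun f g v = concatFun f g w := by
  rcases le_or_ge (m 1) hk hne with ⟨h1, h2⟩ | ⟨h1, h2⟩
  · unfold concatFun
    rw [if_pos h1, if_pos h2]
    exact f.extend_isMap v w k hk hne
  · rw [concatFun_of_ge f g v h1, concatFun_of_ge f g w h2]
    obtain ⟨h3, h4⟩ := shift_adj hm h1 h2 hk hne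
    exact g.extend_isMap _ _ k h3 h4

theorem concatFun_mem {V : Type*} {P : BasedPair V} {n : ℕ} {m l : Fin (n + 2) → ℕ}
    (f : GridMap P m) (g : GridMap P l) (v : Fin (n + 2) → ℕ) (hv : v 0 = 0) :
    concatFun f g v ∈ P.A.verts := by
  unfold concatFun
  split_ifs
  · exact f.extend_mem v hv
  · exact g.extend_mem _ (by simpa [shift] using hv)

theorem concatFun_mapsInto {V : Type*} {P : BasedPair V} {n : ℕ} {m l : Fin (n + 2) → ℕ}
    (f : GridMap P m) (g : GridMap P l) (hm : Even (m 1)) (v w : Fin (n + 2) → ℕ)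
    (hv : v 0 = 0) (hw : w 0 = 0) (k : Fin (n + 2))
    (hk : LineAdj (v k) (w k)) (hne : ∀ j, j ≠ k → v j = w j) :
    P.A.Adj (concatFun f g v) (concatFun f g w) ∨ concatFun f g v = concatFun f g w := by
  rcases le_or_ge (m 1) hk hne with ⟨h1, h2⟩ | ⟨h1, h2⟩
  · unfold concatFun
    rw [if_pos h1, if_pos h2]
    exact f.extend_mapsInto v w hv hw k hk hne
  · rw [concatFun_of_ge f g v h1, concatFun_of_ge f g w h2]
    obtain ⟨h3, h4⟩ := shift_adj hm h1 h2 hk hne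
    exact g.extend_mapsInto _ _ (by simpa [shift] using hv) (by simpa [shift] using hw) k h3 h4

/-- The concatenation `f · g` along the second coordinate, where the second length of `f` is even
(so that the arrows of the two grids fit together). In the other coordinates `f` and `g` are first
extended by the constant `x₀` to a common length. -/
def GridMap.concat {V : Type*} {P : BasedPair V} {n : ℕ} {m l : Fin (n + 2) → ℕ}
    (f : GridMap P m) (g : GridMap P l) (hm : Even (m 1)) : GridMap P (concatSize m l) where
  toFun v := concatFun f g fun k => v k
  isMap v w h := by
    obtain ⟨k, hk, hne⟩ := h
    exact concatFun_isMap f g hm _ _ k hk fun j hj => congrArg Fin.val (hne j hj)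
  boundary := by
    have key : ∀ (v : GridVertex (concatSize m l)) (k), IsEnd (v k) →
        ((v 0 : ℕ) = 0 ∧ k = 0) ∨ concatFun f g (fun k => v k) = P.x₀ := by
      rintro v k (hk | hk)
      · have hk' : (v k : ℕ) = 0 := congrArg Fin.val hk
        by_cases h0 : k = 0
        · subst h0; exact Or.inl ⟨hk', rfl⟩
        · exact Or.inr (concatFun_horn f g _ (Or.inr ⟨k, h0, hk'⟩))
      · exact Or.inr (concatFun_horn f g _ (Or.inl ⟨k, (congrArg Fin.val hk).ge⟩))
    refine ⟨fun v hv => ?_, fun v w hvw => ?_⟩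
    · obtain ⟨k, hk⟩ := hv
      rcases key v k hk with ⟨h, _⟩ | h
      · exact concatFun_mem f g _ h
      · exact (congrArg (· ∈ P.A.verts) h).mpr P.mem
    · obtain ⟨⟨j, hj, hne⟩, k, hk, e⟩ := hvw
      rcases key v k hk with ⟨h, rfl⟩ | h
      · exact concatFun_mapsInto f g hm _ _ h ((congrArg Fin.val e).symm.trans h) j hj
          fun i hi => congrArg Fin.val (hne i hi)
      · rcases key w k (e ▸ hk) with ⟨h', rfl⟩ | h'
        · exact concatFun_mapsInto f g hm _ _ ((congrArg Fin.val e).trans h') h' j hj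
            fun i hi => congrArg Fin.val (hne i hi)
        · exact Or.inr (h.trans h'.symm)
  horn v hv := by
    apply concatFun_horn
    rcases hv with hv | ⟨k, hk, hv | hv⟩
    · exact Or.inl ⟨0, (congrArg Fin.val hv).ge⟩
    · exact Or.inr ⟨k, hk, congrArg Fin.val hv⟩
    · exact Or.inl ⟨k, (congrArg Fin.val hv).ge⟩

/-! ### Homology of sequences of modules -/

section Homology

variable {R : Type*} [CommRing R] {M : ℕ → Type*} [∀ n, AddCommGroup (M n)] [∀ n, Module R (M n)]

/-- The differential out of degree `n`, which is `0` for `n = 0`. -/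
def outgoing (d : ∀ n, M (n + 1) →ₗ[R] M n) : ∀ n, M n →ₗ[R] M (n - 1)
  | 0 => 0
  | n + 1 => d n

/-- The `n`-th homology module, cycles modulo boundaries, of a chain complex
`⋯ → M 2 → M 1 → M 0 → 0`. -/
abbrev Homology (d : ∀ n, M (n + 1) →ₗ[R] M n) (n : ℕ) : Type _ :=
  LinearMap.ker (outgoing d n) ⧸
    (LinearMap.range (d n)).submoduleOf (LinearMap.ker (outgoing d n))

/-- The homology class of a cycle. -/
def Homology.mk (d : ∀ n, M (n + 1) →ₗ[R] M n) (n : ℕ) (z : M n) (hz : outgoing d n z = 0) :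
    Homology d n :=
  Submodule.Quotient.mk ⟨z, hz⟩

theorem Homology.mk_eq_zero (d : ∀ n, M (n + 1) →ₗ[R] M n) (n : ℕ) (z : M n)
    (hz : outgoing d n z = 0) (h : z ∈ LinearMap.range (d n)) : Homology.mk d n z hz = 0 :=
  (Submodule.Quotient.mk_eq_zero _).2 h

variable {M' : ℕ → Type*} [∀ n, AddCommGroup (M' n)] [∀ n, Module R (M' n)]

theorem outgoing_comm {d : ∀ n, M (n + 1) →ₗ[R] M n} {d' : ∀ n, M' (n + 1) →ₗ[R] M' n}
    (φ : ∀ n, M n →ₗ[R] M' n) (hφ : ∀ n x, φ n (d n x) = d' n (φ (n + 1) x)) (n : ℕ) (x : M n) :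
    φ (n - 1) (outgoing d n x) = outgoing d' n (φ n x) := by
  cases n with
  | zero => simp [outgoing]
  | succ n => exact hφ n x

/-- The map induced on homology by a chain map. -/
def Homology.map {d : ∀ n, M (n + 1) →ₗ[R] M n} {d' : ∀ n, M' (n + 1) →ₗ[R] M' n}
    (φ : ∀ n, M n →ₗ[R] M' n) (hφ : ∀ n x, φ n (d n x) = d' n (φ (n + 1) x)) (n : ℕ) :
    Homology d n →ₗ[R] Homology d' n :=
  Submodule.mapQ _ _
    ((φ n).restrict (p := LinearMap.ker (outgoing d n)) (q := LinearMap.ker (outgoing d' n))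
      fun x hx => by
        rw [LinearMap.mem_ker] at hx ⊢
        rw [← outgoing_comm φ hφ, hx, map_zero]) <| by
    rintro ⟨x, hx⟩ ⟨y, hy⟩
    exact ⟨φ (n + 1) y, (hφ n y).symm.trans (congrArg (φ n) hy)⟩

/-- The terms of the quotient complex `M' / i(M)`. -/
def QuotTerm (i : ∀ n, M n →ₗ[R] M' n) (n : ℕ) : Type _ := M' n ⧸ LinearMap.range (i n)

instance (i : ∀ n, M n →ₗ[R] M' n) (n : ℕ) : AddCommGroup (QuotTerm i n) :=
  inferInstanceAs (AddCommGroup (M' n ⧸ LinearMap.range (i n)))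

instance (i : ∀ n, M n →ₗ[R] M' n) (n : ℕ) : Module R (QuotTerm i n) :=
  inferInstanceAs (Module R (M' n ⧸ LinearMap.range (i n)))

/-- The projection `M' → M' / i(M)`. -/
def QuotTerm.mk (i : ∀ n, M n →ₗ[R] M' n) (n : ℕ) : M' n →ₗ[R] QuotTerm i n :=
  Submodule.mkQ (LinearMap.range (i n))

theorem QuotTerm.mk_surjective (i : ∀ n, M n →ₗ[R] M' n) (n : ℕ) :
    Function.Surjective (QuotTerm.mk i n) :=
  Submodule.mkQ_surjective _

theorem QuotTerm.mk_eq_zero (i : ∀ n, M n →ₗ[R] M' n) (n : ℕ) (x : M' n) :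
    QuotTerm.mk i n x = 0 ↔ ∃ y, i n y = x :=
  Submodule.Quotient.mk_eq_zero _

/-- The differential of the quotient complex `M' / i(M)`. -/
def quotDiff {d : ∀ n, M (n + 1) →ₗ[R] M n} {d' : ∀ n, M' (n + 1) →ₗ[R] M' n}
    (i : ∀ n, M n →ₗ[R] M' n) (hi : ∀ n x, i n (d n x) = d' n (i (n + 1) x)) (n : ℕ) :
    QuotTerm i (n + 1) →ₗ[R] QuotTerm i n :=
  Submodule.mapQ (LinearMap.range (i (n + 1))) (LinearMap.range (i n)) (d' n) <| by
    rintro _ ⟨x, rfl⟩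
    exact ⟨d n x, hi n x⟩

section Connecting

theorem connecting_cycle {d : ∀ n, M (n + 1) →ₗ[R] M n} {d' : ∀ n, M' (n + 1) →ₗ[R] M' n}
    (i : ∀ n, M n →ₗ[R] M' n) (hi : ∀ n x, i n (d n x) = d' n (i (n + 1) x))
    (inj : ∀ n, Function.Injective (i n)) (dd : ∀ n x, d' n (d' (n + 1) x) = 0)
    (n : ℕ) (c : M' (n + 1)) (a : M n) (h : i n a = d' n c) : outgoing d n a = 0 := by
  cases n with
  | zero => rfl
  | succ n =>
    apply inj
    rw [map_zero]
    exact (hi n a).trans (by rw [h, dd])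

theorem connecting_exists {d : ∀ n, M (n + 1) →ₗ[R] M n} {d' : ∀ n, M' (n + 1) →ₗ[R] M' n}
    (i : ∀ n, M n →ₗ[R] M' n) (hi : ∀ n x, i n (d n x) = d' n (i (n + 1) x))
    (n : ℕ) (z : LinearMap.ker (outgoing (quotDiff i hi) (n + 1))) :
    ∃ p : M' (n + 1) × M n,
      QuotTerm.mk i (n + 1) p.1 = z.1 ∧ i n p.2 = d' n p.1 := by
  obtain ⟨z, hz⟩ := z
  obtain ⟨c, rfl⟩ := QuotTerm.mk_surjective i (n + 1) z
  obtain ⟨a, ha⟩ := (QuotTerm.mk_eq_zero i n (d' n c)).1 (LinearMap.mem_ker.1 hz)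
  exact ⟨(c, a), rfl, ha⟩

theorem connecting_unique {d : ∀ n, M (n + 1) →ₗ[R] M n} {d' : ∀ n, M' (n + 1) →ₗ[R] M' n}
    (i : ∀ n, M n →ₗ[R] M' n) (hi : ∀ n x, i n (d n x) = d' n (i (n + 1) x))
    (inj : ∀ n, Function.Injective (i n)) (n : ℕ) (c c' : M' (n + 1)) (a a' : M n)
    (hc : QuotTerm.mk i (n + 1) c = QuotTerm.mk i (n + 1) c')
    (h : i n a = d' n c) (h' : i n a' = d' n c') (hz : outgoing d n a = 0)
    (hz' : outgoing d n a' = 0) : Homology.mk d n a hz = Homology.mk d n a' hz' := by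
  obtain ⟨b, hb⟩ := (QuotTerm.mk_eq_zero i (n + 1) (c - c')).1 (by rw [map_sub, hc, sub_self])
  refine (Submodule.Quotient.eq _).2 ⟨b, inj n ?_⟩
  rw [hi, hb, map_sub]
  simp [h, h']

variable {d : ∀ n, M (n + 1) →ₗ[R] M n} {d' : ∀ n, M' (n + 1) →ₗ[R] M' n}
  (i : ∀ n, M n →ₗ[R] M' n) (hi : ∀ n x, i n (d n x) = d' n (i (n + 1) x))
  (inj : ∀ n, Function.Injective (i n)) (dd : ∀ n x, d' n (d' (n + 1) x) = 0)

/-- The connecting homomorphism `H_{n+1}(M'/M) → H_n(M)` of the short exact sequence of complexes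
`0 → M → M' → M'/M → 0`: lift a relative cycle to a chain `c` of `M'`, and take the class of the
cycle `a` of `M` with `i a = d' c`. -/
def connecting (n : ℕ) : Homology (quotDiff i hi) (n + 1) →ₗ[R] Homology d n :=
  Submodule.liftQ _
    { toFun := fun z => Homology.mk d n (connecting_exists i hi n z).choose.2
        (connecting_cycle i hi inj dd n _ _ (connecting_exists i hi n z).choose_spec.2)
      map_add' := fun z w => by
        have h1 := (connecting_exists i hi n z).choose_spec
        have h2 := (connecting_exists i hi n w).choose_spec
        have h3 := (connecting_exists i hi n (z + w)).choose_spec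
        refine (connecting_unique i hi inj n _ ((connecting_exists i hi n z).choose.1 +
          (connecting_exists i hi n w).choose.1) _ ((connecting_exists i hi n z).choose.2 +
          (connecting_exists i hi n w).choose.2) ?_ h3.2 ?_ _
          (connecting_cycle i hi inj dd n ((connecting_exists i hi n z).choose.1 +
          (connecting_exists i hi n w).choose.1) _ ?_)).trans rfl
        · rw [map_add, h3.1, h1.1, h2.1]; rfl
        · rw [map_add, map_add, h1.2, h2.2]
        · rw [map_add, map_add, h1.2, h2.2]
      map_smul' := fun r z => by
        have h1 := (connecting_exists i hi n z).choose_spec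
        have h3 := (connecting_exists i hi n (r • z)).choose_spec
        refine (connecting_unique i hi inj n _ (r • (connecting_exists i hi n z).choose.1) _
          (r • (connecting_exists i hi n z).choose.2) ?_ h3.2 ?_ _
          (connecting_cycle i hi inj dd n (r • (connecting_exists i hi n z).choose.1) _ ?_)).trans
          rfl
        · rw [map_smul, h3.1, h1.1]; rfl
        · rw [map_smul, map_smul, h1.2]
        · rw [map_smul, map_smul, h1.2] } <| by
    rintro ⟨z, hz⟩ ⟨w, hw⟩
    obtain ⟨e, rfl⟩ := QuotTerm.mk_surjective i (n + 2) w
    rw [LinearMap.mem_ker]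
    have h3 := (connecting_exists i hi n ⟨z, hz⟩).choose_spec
    refine (connecting_unique i hi inj n _ (d' (n + 1) e) _ 0 (h3.1.trans hw.symm) h3.2
      (by rw [map_zero, dd]) _ (map_zero _)).trans ?_
    exact Homology.mk_eq_zero d n 0 (map_zero _) (Submodule.zero_mem _)

theorem connecting_mk (n : ℕ) (c : M' (n + 1)) (a : M n) (h : i n a = d' n c)
    (hz : outgoing (quotDiff i hi) (n + 1) (QuotTerm.mk i (n + 1) c) = 0) :
    connecting i hi inj dd n (Homology.mk _ (n + 1) (QuotTerm.mk i (n + 1) c) hz) =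
      Homology.mk d n a (connecting_cycle i hi inj dd n c a h) := by
  have h3 := (connecting_exists i hi n ⟨QuotTerm.mk i (n + 1) c, hz⟩).choose_spec
  exact connecting_unique i hi inj n _ c _ a h3.1 h3.2 h _ _

end Connecting

end Homology

/-! ### Cubical homology -/

/-- The unit cube `J_1^{□n}`. -/
abbrev cube (n : ℕ) : Digraph (GridVertex fun _ : Fin n => 1) := grid fun _ : Fin n => 1

/-- Singular `n`-cubes of `G`: digraph maps `J_1^{□n} → G`. -/
def Cube {V : Type*} (G : Digraph V) (n : ℕ) : Type _ :=
  {c : GridVertex (fun _ : Fin n => 1) → V // IsMap (cube n) G c}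

theorem isMap_face {n : ℕ} (i : Fin (n + 1)) (t : Fin 2) :
    IsMap (cube n) (cube (n + 1)) fun x => i.insertNth t x := by
  rintro x y ⟨k, hk, hne⟩
  refine Or.inl ⟨i.succAbove k, by simpa using hk, fun j => ?_⟩
  refine i.succAboveCases ?_ (fun j => ?_) j
  · simp
  · intro hj
    simpa using hne j fun e => hj (congrArg _ e)

theorem isMap_degeneracy {n : ℕ} (i : Fin (n + 1)) :
    IsMap (cube (n + 1)) (cube n) fun x j => x (i.succAbove j) := by
  rintro x y ⟨k, hk, hne⟩
  by_cases h : k = i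
  · subst h
    exact Or.inr (funext fun j => hne _ (Fin.succAbove_ne _ _))
  · obtain ⟨k, rfl⟩ := Fin.exists_succAbove_eq h
    exact Or.inl ⟨k, hk, fun j hj => hne _ fun e => hj (Fin.succAbove_right_injective e)⟩

theorem IsMap.comp {U V W : Type*} {F : Digraph U} {G : Digraph V} {H : Digraph W} {g : V → W}
    {f : U → V} (hg : IsMap G H g) (hf : IsMap F G f) : IsMap F H fun x => g (f x) := by
  intro x y h
  rcases hf h with h | h
  · exact hg h
  · exact Or.inr (congrArg g h)

/-- The face `c ∘ F_{i,t}`, where `F_{i,t}` inserts `t` in position `i`. -/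
def Cube.face {V : Type*} {G : Digraph V} {n : ℕ} (c : Cube G (n + 1)) (i : Fin (n + 1))
    (t : Fin 2) : Cube G n :=
  ⟨fun x => c.1 (i.insertNth t x), c.2.comp (isMap_face i t)⟩

/-- The degenerate cube `c ∘ S_i`, where `S_i` omits the coordinate `i`. -/
def Cube.degenerate {V : Type*} {G : Digraph V} {n : ℕ} (c : Cube G n) (i : Fin (n + 1)) :
    Cube G (n + 1) :=
  ⟨fun x => c.1 fun j => x (i.succAbove j), c.2.comp (isMap_degeneracy i)⟩

/-- The cube `f ∘ c` for a digraph map `f`. -/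
def Cube.map {V W : Type*} {G : Digraph V} {H : Digraph W} {f : V → W} (hf : IsMap G H f) {n : ℕ}
    (c : Cube G n) : Cube H n :=
  ⟨fun x => f (c.1 x), hf.comp c.2⟩

section Cubical

variable (R : Type*) [CommRing R] {V W : Type*} {G : Digraph V} {H : Digraph W}

/-- The module of singular cubical `n`-chains. -/
abbrev Chain (G : Digraph V) (n : ℕ) : Type _ := Cube G n →₀ R

/-- The cubical boundary operator `∂ c = ∑_{i=1}^{n+1} (-1)^i (c ∘ F_{i,0} - c ∘ F_{i,1})`
(in the sum below the index `i` starts from `0`). -/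
def bd (G : Digraph V) (n : ℕ) : Chain R G (n + 1) →ₗ[R] Chain R G n :=
  Finsupp.linearCombination R fun c : Cube G (n + 1) =>
    ∑ i : Fin (n + 1), (-1 : R) ^ ((i : ℕ) + 1) •
      (Finsupp.single (c.face i 0) (1 : R) - Finsupp.single (c.face i 1) (1 : R))

/-- The submodule generated by the degenerate cubes. -/
def degenerateChains (G : Digraph V) : ∀ n, Submodule R (Chain R G n)
  | 0 => ⊥
  | n + 1 => Submodule.span R
      (Set.range fun p : Cube G n × Fin (n + 1) => Finsupp.single (p.1.degenerate p.2) (1 : R))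

theorem bd_single (n : ℕ) (c : Cube G (n + 1)) :
    bd R G n (Finsupp.single c 1) = ∑ i : Fin (n + 1), (-1 : R) ^ ((i : ℕ) + 1) •
      (Finsupp.single (c.face i 0) (1 : R) - Finsupp.single (c.face i 1) (1 : R)) := by
  simp [bd]

/-- A cube that does not depend on its `i`-th coordinate is degenerate. -/
theorem Cube.eq_degenerate {n : ℕ} (c : Cube G (n + 1)) (i : Fin (n + 1))
    (h : ∀ x y, (∀ j, j ≠ i → x j = y j) → c.1 x = c.1 y) : c = (c.face i 0).degenerate i := by
  refine Subtype.ext (funext fun x => h _ _ fun j hj => ?_)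
  obtain ⟨j, rfl⟩ := Fin.exists_succAbove_eq hj
  simp

theorem Cube.degenerate_indep {n : ℕ} (c : Cube G n) (i : Fin (n + 1))
    (x y : GridVertex fun _ : Fin (n + 1) => 1) (h : ∀ j, j ≠ i → x j = y j) :
    (c.degenerate i).1 x = (c.degenerate i).1 y :=
  congrArg c.1 (funext fun _ => h _ (Fin.succAbove_ne _ _))

theorem degenerate_face_mem {n : ℕ} (c : Cube G n) (i j : Fin (n + 1)) (hij : j ≠ i) (t : Fin 2) :
    Finsupp.single ((c.degenerate i).face j t) (1 : R) ∈ degenerateChains R G n := by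
  obtain ⟨k, rfl⟩ := Fin.exists_succAbove_eq hij.symm
  cases n with
  | zero => exact k.elim0
  | succ n =>
    refine Submodule.subset_span ⟨(_, k), congrArg (Finsupp.single · (1 : R))
      (Cube.eq_degenerate _ k fun x y h => ?_).symm⟩
    refine c.degenerate_indep _ _ _ fun l => ?_
    refine j.succAboveCases ?_ (fun l => ?_) l
    · simp
    · intro hl
      simpa using h l fun e => hl (congrArg _ e)

theorem bd_degenerate (n : ℕ) :
    degenerateChains R G (n + 1) ≤ (degenerateChains R G n).comap (bd R G n) := by
  refine Submodule.span_le.2 ?_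
  rintro _ ⟨⟨c, i⟩, rfl⟩
  change bd R G n (Finsupp.single (c.degenerate i) 1) ∈ degenerateChains R G n
  rw [bd_single]
  refine Submodule.sum_mem _ fun j _ => Submodule.smul_mem _ _ ?_
  by_cases hij : j = i
  · subst hij
    have : (c.degenerate j).face j 0 = (c.degenerate j).face j 1 :=
      Subtype.ext (funext fun x => c.degenerate_indep j _ _ fun l hl => by
        obtain ⟨l, rfl⟩ := Fin.exists_succAbove_eq hl
        simp)
    rw [this, sub_self]
    exact Submodule.zero_mem _
  · exact Submodule.sub_mem _ (degenerate_face_mem R c i j hij 0)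
      (degenerate_face_mem R c i j hij 1)

/-- The normalized cubical chains: chains modulo degenerate chains. -/
def NChain (G : Digraph V) (n : ℕ) : Type _ := Chain R G n ⧸ degenerateChains R G n

instance (G : Digraph V) (n : ℕ) : AddCommGroup (NChain R G n) :=
  inferInstanceAs (AddCommGroup (Chain R G n ⧸ degenerateChains R G n))

instance (G : Digraph V) (n : ℕ) : Module R (NChain R G n) :=
  inferInstanceAs (Module R (Chain R G n ⧸ degenerateChains R G n))

/-- The normalized chain of a chain. -/
def NChain.mk (G : Digraph V) (n : ℕ) : Chain R G n →ₗ[R] NChain R G n :=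
  Submodule.mkQ (degenerateChains R G n)

theorem NChain.mk_surjective (G : Digraph V) (n : ℕ) : Function.Surjective (NChain.mk R G n) :=
  Submodule.mkQ_surjective _

theorem NChain.mk_eq_zero (G : Digraph V) (n : ℕ) (x : Chain R G n) :
    NChain.mk R G n x = 0 ↔ x ∈ degenerateChains R G n :=
  Submodule.Quotient.mk_eq_zero _

/-- The boundary operator on normalized chains. -/
def nbd (G : Digraph V) (n : ℕ) : NChain R G (n + 1) →ₗ[R] NChain R G n :=
  Submodule.mapQ (degenerateChains R G (n + 1)) (degenerateChains R G n) (bd R G n) (bd_degenerate R n)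

/-- The cubical homology `H^c_n(G)` with coefficients in `R`. -/
abbrev CubicalHomology (G : Digraph V) (n : ℕ) : Type _ := Homology (nbd R G) n

/-- The map on chains induced by a digraph map. -/
def chainMap {f : V → W} (hf : IsMap G H f) (n : ℕ) : Chain R G n →ₗ[R] Chain R H n :=
  Finsupp.lmapDomain R R (Cube.map hf)

theorem chainMap_single {f : V → W} (hf : IsMap G H f) (n : ℕ) (c : Cube G n) :
    chainMap R hf n (Finsupp.single c 1) = Finsupp.single (c.map hf) 1 := by
  simp [chainMap]

theorem chainMap_degenerate {f : V → W} (hf : IsMap G H f) (n : ℕ) :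
    degenerateChains R G n ≤ (degenerateChains R H n).comap (chainMap R hf n) := by
  cases n with
  | zero => exact bot_le
  | succ n =>
    refine Submodule.span_le.2 ?_
    rintro _ ⟨⟨c, i⟩, rfl⟩
    change chainMap R hf (n + 1) (Finsupp.single (c.degenerate i) 1) ∈ degenerateChains R H (n + 1)
    rw [chainMap_single]
    exact Submodule.subset_span ⟨(c.map hf, i), rfl⟩

theorem chainMap_bd {f : V → W} (hf : IsMap G H f) (n : ℕ) (x : Chain R G (n + 1)) :
    chainMap R hf n (bd R G n x) = bd R H n (chainMap R hf (n + 1) x) := by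
  suffices h : chainMap R hf n ∘ₗ bd R G n = bd R H n ∘ₗ chainMap R hf (n + 1) from
    LinearMap.congr_fun h x
  refine Finsupp.lhom_ext' fun c => LinearMap.ext_ring ?_
  simp only [LinearMap.comp_apply, Finsupp.lsingle_apply, bd_single, chainMap_single, map_sum,
    map_smul, map_sub]
  rfl

/-- The map on normalized chains induced by a digraph map. -/
def nmap {f : V → W} (hf : IsMap G H f) (n : ℕ) : NChain R G n →ₗ[R] NChain R H n :=
  Submodule.mapQ (degenerateChains R G n) (degenerateChains R H n) (chainMap R hf n)
    (chainMap_degenerate R hf n)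

theorem nmap_nbd {f : V → W} (hf : IsMap G H f) (n : ℕ) (x : NChain R G (n + 1)) :
    nmap R hf n (nbd R G n x) = nbd R H n (nmap R hf (n + 1) x) := by
  obtain ⟨x, rfl⟩ := NChain.mk_surjective R G (n + 1) x
  exact congrArg (NChain.mk R H n) (chainMap_bd R hf n x)

/-! ### Relative cubical homology -/

theorem Subdigraph.isMap_val (A : Subdigraph G) : IsMap A.coe G Subtype.val :=
  fun _ _ h => Or.inl (A.adj_sub h)

/-- The inclusion of the normalized chains of `A` into those of `G`. -/
def incl (A : Subdigraph G) (n : ℕ) : NChain R A.coe n →ₗ[R] NChain R G n := nmap R A.isMap_val n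

/-- Relative normalized chains: normalized chains of `G` modulo those of `A`. -/
abbrev RelChain (A : Subdigraph G) (n : ℕ) : Type _ := QuotTerm (incl R A) n

/-- The boundary operator on relative normalized chains. -/
def relBd (A : Subdigraph G) (n : ℕ) : RelChain R A (n + 1) →ₗ[R] RelChain R A n :=
  quotDiff (incl R A) (nmap_nbd R A.isMap_val) n

/-- The relative cubical homology `H^c_n(G, A)` with coefficients in `R`. -/
abbrev RelHomology (A : Subdigraph G) (n : ℕ) : Type _ := Homology (relBd R A) n

theorem MapsInto.isMap {f : V → W} {A : Subdigraph G} {B : Subdigraph H} (h : MapsInto f A B) :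
    IsMap A.coe B.coe fun a => ⟨f a, h.1 a a.2⟩ := by
  intro a b hab
  rcases h.2 hab with e | e
  · exact Or.inl e
  · exact Or.inr (Subtype.ext e)

/-- The map on relative chains induced by a map of pairs. -/
def relMap {f : V → W} (hf : IsMap G H f) {A : Subdigraph G} {B : Subdigraph H}
    (h : MapsInto f A B) (n : ℕ) : RelChain R A n →ₗ[R] RelChain R B n :=
  Submodule.mapQ (LinearMap.range (incl R A n)) (LinearMap.range (incl R B n)) (nmap R hf n) <| by
    rintro _ ⟨x, rfl⟩
    refine ⟨nmap R h.isMap n x, ?_⟩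
    obtain ⟨x, rfl⟩ := NChain.mk_surjective R _ n x
    refine congrArg (NChain.mk R H n) ?_
    change Finsupp.mapDomain _ (Finsupp.mapDomain _ x) = Finsupp.mapDomain _ (Finsupp.mapDomain _ x)
    rw [← Finsupp.mapDomain_comp, ← Finsupp.mapDomain_comp]
    rfl

/-- The map `H^c_n(G, A) → H^c_n(H, B)` induced by a based map of pairs. -/
def relHomologyMap {P : BasedPair V} {Q : BasedPair W} (φ : P.Hom Q) (n : ℕ) :
    RelHomology R P.A n →ₗ[R] RelHomology R Q.A n :=
  Homology.map (relMap R φ.isMap φ.mapsInto) (fun n x => by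
    obtain ⟨x, rfl⟩ := QuotTerm.mk_surjective _ (n + 1) x
    exact congrArg (QuotTerm.mk (incl R Q.A) n) (nmap_nbd R φ.isMap n x)) n

theorem incl_injective (A : Subdigraph G) (n : ℕ) : Function.Injective (incl R A n) := by
  have hinj : Function.Injective (Cube.map (n := n) A.isMap_val) := fun c c' h =>
    Subtype.ext (funext fun x => Subtype.ext (congrFun (congrArg Subtype.val h) x))
  rw [injective_iff_map_eq_zero]
  intro x hx
  obtain ⟨x, rfl⟩ := NChain.mk_surjective R _ n x
  have hx' : chainMap R A.isMap_val n x ∈ degenerateChains R G n :=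
    (NChain.mk_eq_zero R G n _).1 hx
  rw [NChain.mk_eq_zero]
  cases n with
  | zero =>
    have h0 : Finsupp.mapDomain (Cube.map A.isMap_val) x = 0 := (Submodule.mem_bot R).1 hx'
    exact (Submodule.mem_bot R).2
      (Finsupp.mapDomain_injective hinj (h0.trans Finsupp.mapDomain_zero.symm))
  | succ n =>
    have h1 : degenerateChains R G (n + 1) =
        Finsupp.supported R R (Set.range fun p : Cube G n × Fin (n + 1) => p.1.degenerate p.2) := by
      rw [Finsupp.supported_eq_span_single, ← Set.range_comp]
      rfl
    have h2 : degenerateChains R A.coe (n + 1) = Finsupp.supported R R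
        (Set.range fun p : Cube A.coe n × Fin (n + 1) => p.1.degenerate p.2) := by
      rw [Finsupp.supported_eq_span_single, ← Set.range_comp]
      rfl
    rw [h1, Finsupp.mem_supported] at hx'
    rw [h2, Finsupp.mem_supported]
    intro c hc
    have h3 : c.map A.isMap_val ∈ (chainMap R A.isMap_val (n + 1) x).support := by
      rw [Finsupp.mem_support_iff]
      change Finsupp.mapDomain _ x _ ≠ 0
      rw [Finsupp.mapDomain_apply hinj]
      exact Finsupp.mem_support_iff.1 hc
    obtain ⟨⟨g, i⟩, hg⟩ := hx' h3
    refine ⟨(c.face i 0, i), (c.eq_degenerate i fun x y h => Subtype.ext ?_).symm⟩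
    have h4 := g.degenerate_indep i x y h
    change (g.degenerate i) = _ at hg
    rw [hg] at h4
    exact h4

theorem face_face {n : ℕ} (c : Cube G (n + 2)) (i j : Fin (n + 1)) (h : i ≤ j) (s t : Fin 2) :
    (c.face j.succ t).face i s = (c.face i.castSucc s).face j t := by
  refine Subtype.ext (funext fun x => congrArg c.1 ?_)
  change (j.succ.insertNth t (i.insertNth s x : GridVertex fun _ : Fin (n + 1) => 1) :
      GridVertex fun _ : Fin (n + 2) => 1) =
    i.castSucc.insertNth s (j.insertNth t x : GridVertex fun _ : Fin (n + 1) => 1)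
  have h1 : j.succ.succAbove i = i.castSucc :=
    Fin.succAbove_of_castSucc_lt _ _ (Fin.castSucc_lt_succ_iff.2 h)
  have h2 : i.castSucc.succAbove j = j.succ :=
    Fin.succAbove_of_le_castSucc _ _ (Fin.castSucc_le_castSucc_iff.2 h)
  funext l
  refine j.succ.succAboveCases ?_ (fun l => ?_) l
  · rw [Fin.insertNth_apply_same, ← h2, Fin.insertNth_apply_succAbove, Fin.insertNth_apply_same]
  · rw [Fin.insertNth_apply_succAbove]
    refine i.succAboveCases ?_ (fun l => ?_) l
    · rw [Fin.insertNth_apply_same, h1, Fin.insertNth_apply_same]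
    · have h3 : j.succ.succAbove (i.succAbove l) = i.castSucc.succAbove (j.succAbove l) := by
        ext
        simp only [Fin.succAbove, Fin.lt_def, Fin.val_castSucc, Fin.val_succ]
        have := Fin.le_def.1 h
        split_ifs <;> simp at * <;> omega
      rw [Fin.insertNth_apply_succAbove, h3, Fin.insertNth_apply_succAbove,
        Fin.insertNth_apply_succAbove]

theorem sum_cancel {M : Type*} [AddCommGroup M] {n : ℕ} (F : Fin (n + 2) → Fin (n + 1) → M)
    (h : ∀ i j : Fin (n + 1), i ≤ j → F j.succ i = -F i.castSucc j) :
    ∑ j, ∑ i, F j i = 0 := by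
  rw [← Finset.sum_product', Finset.univ_product_univ,
    ← Finset.sum_filter_add_sum_filter_not Finset.univ
      fun p : Fin (n + 2) × Fin (n + 1) => p.2.castSucc < p.1, ← eq_neg_iff_add_eq_zero,
    ← Finset.sum_neg_distrib]
  refine Finset.sum_bij' (fun p hp => (p.2.castSucc, p.1.pred ?_))
    (fun p hp => (p.2.succ, p.1.castPred ?_)) ?_ ?_ ?_ ?_ ?_
  · exact Fin.ne_zero_of_lt (Finset.mem_filter.1 hp).2
  · exact Fin.ne_last_of_lt
      (lt_of_le_of_lt (not_lt.1 (Finset.mem_filter.1 hp).2) (Fin.castSucc_lt_last p.2))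
  · rintro ⟨a, b⟩ hp
    have h1 : (b : ℕ) < a := (Finset.mem_filter.1 hp).2
    simp [Fin.le_def]
    omega
  · rintro ⟨a, b⟩ hp
    have h1 : (a : ℕ) ≤ b := not_lt.1 (Finset.mem_filter.1 hp).2
    simp [Fin.lt_def]
    omega
  · rintro ⟨a, b⟩ hp; simp
  · rintro ⟨a, b⟩ hp; simp
  · rintro ⟨a, b⟩ hp
    have h1 : (b : ℕ) < a := (Finset.mem_filter.1 hp).2
    have h0 : a ≠ 0 := by
      rintro rfl
      simp at h1
    obtain ⟨a, rfl⟩ := Fin.exists_succ_eq.2 h0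
    simp only [Fin.pred_succ]
    rw [Fin.val_succ] at h1
    exact h b a (Fin.le_def.2 (by omega))

theorem nbd_nbd (G : Digraph V) (n : ℕ) (x : NChain R G (n + 2)) :
    nbd R G n (nbd R G (n + 1) x) = 0 := by
  obtain ⟨x, rfl⟩ := NChain.mk_surjective R G (n + 2) x
  suffices h : bd R G n ∘ₗ bd R G (n + 1) = 0 from
    congrArg (NChain.mk R G n) (LinearMap.congr_fun h x)
  refine Finsupp.lhom_ext' fun c => LinearMap.ext_ring ?_
  simp only [LinearMap.comp_apply, Finsupp.lsingle_apply, bd_single, map_sum, map_smul, map_sub,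
    LinearMap.zero_apply, ← Finset.sum_sub_distrib, Finset.smul_sum]
  refine sum_cancel _ fun i j hij => ?_
  rw [face_face c i j hij, face_face c i j hij, face_face c i j hij, face_face c i j hij,
    Fin.val_succ, Fin.val_castSucc]
  module

/-- The boundary map `ξ : H^c_{n+1}(G, A) → H^c_n(A)` of the long exact sequence of the pair. -/
def relConnecting (A : Subdigraph G) (n : ℕ) :
    RelHomology R A (n + 1) →ₗ[R] CubicalHomology R A.coe n :=
  connecting (incl R A) (nmap_nbd R A.isMap_val) (incl_injective R A) (nbd_nbd R G) n

end Cubical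

/-! ### The chain of a grid map -/

/-- The isomorphism `σ_i` of the unit cube `J_1^{□n}` onto the unit subcube of the grid with
smallest vertex `i = (i_1, …, i_n)`. Its `k`-th component sends `0, 1` to `i_k, i_k + 1` when the
arrow is `i_k → i_k + 1` (`i_k` even) and to `i_k + 1, i_k` when it is `i_k + 1 → i_k`. -/
def subcube {n : ℕ} {m : Fin n → ℕ} (i : ∀ k, Fin (m k)) (x : GridVertex fun _ : Fin n => 1) :
    GridVertex m :=
  fun k => if Even (i k : ℕ) ↔ x k = 0 then (i k).castSucc else (i k).succ

theorem subcube_isMap {n : ℕ} {m : Fin n → ℕ} (i : ∀ k, Fin (m k)) :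
    IsMap (cube n) (grid m) (subcube i) := by
  rintro x y ⟨k, hk, hne⟩
  refine Or.inl ⟨k, ?_, fun j hj => by simp only [subcube, hne j hj]⟩
  have h01 : x k = 0 ∧ y k = 1 := by
    have h1 : ((x k : Fin 2) : ℕ) < 2 := (x k).2
    have h2 : ((y k : Fin 2) : ℕ) < 2 := (y k).2
    rcases hk with ⟨h, _⟩ | ⟨h, r, hr⟩
    · exact ⟨Fin.ext (by simp only [Fin.val_zero]; omega), Fin.ext (by simp only [Fin.val_one]; omega)⟩
    · omega
  change LineAdj _ _
  simp only [subcube, h01.1, h01.2]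
  by_cases he : Even (i k : ℕ)
  · simp [he, LineAdj]
  · simp [he, LineAdj, Nat.not_even_iff_odd.1 he]

/-- The total inversion number of `σ_i`: the number of reversed coordinate axes. -/
def inversions {n : ℕ} {m : Fin n → ℕ} (i : ∀ k, Fin (m k)) : ℕ :=
  (Finset.univ.filter fun k => Odd (i k : ℕ)).card

/-- The singular cube `f ∘ σ_i`. -/
def GridMap.cubeAt {V : Type*} {P : BasedPair V} {n : ℕ} [NeZero n] {m : Fin n → ℕ}
    (f : GridMap P m) (i : ∀ k, Fin (m k)) : Cube P.G n :=
  ⟨fun x => f.toFun (subcube i x), f.isMap.comp (subcube_isMap i)⟩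

/-- The chain `∑_i (-1)^{T(σ_i)} f ∘ σ_i` of a triple grid map, as a normalized chain of `G`. -/
def GridMap.chain (R : Type*) [CommRing R] {V : Type*} {P : BasedPair V} {n : ℕ} [NeZero n]
    {m : Fin n → ℕ} (f : GridMap P m) : NChain R P.G n :=
  NChain.mk R P.G n
    (∑ i : ∀ k, Fin (m k), (-1 : R) ^ inversions i • Finsupp.single (f.cubeAt i) (1 : R))

/-- The relative chain `h_n(f)` of a triple grid map. -/
def GridMap.relChain (R : Type*) [CommRing R] {V : Type*} {P : BasedPair V} {n : ℕ} [NeZero n]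
    {m : Fin n → ℕ} (f : GridMap P m) : RelChain R P.A n :=
  QuotTerm.mk (incl R P.A) n (f.chain R)

end

end DigraphHurewicz

namespace DigraphHurewicz

/-! Every grid map extends to the infinite grid by the value `x₀`, and this extension is also its
composite with the clamping retraction, because clamping sends outside vertices to the horn. All
grid sizes thus live on one domain. The chain of `f` becomes a signed sum over a box of lattice
points `i`, with sign `(-1)^(∑ i_k)`, since only the parity of the number of odd coordinates
matters.

For item 2 the key fact is `bd_boxChain`: inside the box the two faces of adjacent cubes cancel. The
sign at odd `i_k` is compensated by the reversal of that axis, so each column telescopes and only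
the outer faces of the box remain. For a triple grid map these are constant except the face `v 0 =
0`, which lies in `A`. This makes `h_n(f)` a relative cycle and also gives item 5, the sign `-1`
being the coefficient of the first axis (`nbd_chain`, `nbd_chain_eq_face`). Applied to a homotopy,
regarded as a map of one more dimension with time as coordinate `0`, the same formula gives homotopy
invariance (`DirectHomotopic.chain_sub_eq`).

Subdivision (item 1): a monotone map of the line pauses or advances by one. Cubes on which some
coordinate pauses are degenerate, and the others correspond bijectively, with equal parities, to the
cubes of the original box (`mk_boxChain_coordinatewise`).

Group structure (item 3): homotopy classes of grid maps are identified with classes of stable maps,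
functions on the infinite grid with bounded support in the based sense (`StableMap.equivClasses`).
There a product may be cut at any sufficiently large even position, associativity and the left unit
hold on the nose, and inverses come from reversing the second coordinate. Additivity is the
splitting of a box into two halves, the second being an even translate of the box of the other
factor. Naturality (item 4) is immediate from composition of cubes. -/

/-! ### Chains of maps on the infinite grid -/

/-- The infinite grid: the box product of `n` copies of the infinite line `0 → 1 ← 2 → ⋯`. -/
def natGrid (n : ℕ) : Digraph (Fin n → ℕ) where
  Adj v w := ∃ k, LineAdj (v k) (w k) ∧ ∀ j, j ≠ k → v j = w j

/-- The isomorphism of the unit cube onto the unit subcube of the infinite grid with smallest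
vertex `i`. -/
def unitCube {n : ℕ} (i : Fin n → ℕ) (x : GridVertex fun _ : Fin n => 1) : Fin n → ℕ :=
  fun k => if Even (i k) ↔ x k = 0 then i k else i k + 1

theorem eq_zero_one_of_lineAdj {a b : Fin 2} (h : (line 1).Adj a b) : a = 0 ∧ b = 1 := by
  have h1 := a.2
  have h2 := b.2
  rcases h with ⟨h, _⟩ | ⟨h, r, hr⟩
  · exact ⟨Fin.ext (by simp only [Fin.val_zero]; omega),
      Fin.ext (by simp only [Fin.val_one]; omega)⟩
  · omega

theorem unitCube_isMap {n : ℕ} (i : Fin n → ℕ) : IsMap (cube n) (natGrid n) (unitCube i) := by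
  rintro x y ⟨k, hk, hne⟩
  refine Or.inl ⟨k, ?_, fun j hj => by simp only [unitCube, hne j hj]⟩
  obtain ⟨h0, h1⟩ := eq_zero_one_of_lineAdj hk
  simp only [unitCube, h0, h1]
  by_cases he : Even (i k)
  · simp [he, LineAdj]
  · simp [he, LineAdj, Nat.not_even_iff_odd.1 he]

theorem unitCube_le {n : ℕ} {i m : Fin n → ℕ} (h : ∀ k, i k < m k)
    (x : GridVertex fun _ : Fin n => 1) (k : Fin n) : unitCube i x k ≤ m k := by
  have := h k
  unfold unitCube
  split_ifs <;> omega

/-- The arrow between `a` and `a + 1` starts at its even end, so the face `t = 0` sits at height `a`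
for even `a` and at height `a + 1` for odd `a`. This exchange is what cancels the alternating sign
in the telescoping of `bd_boxChain`. -/
theorem unitCube_insertNth {n : ℕ} (k : Fin (n + 1)) (a : ℕ) (i : Fin n → ℕ) (t : Fin 2)
    (x : GridVertex fun _ : Fin n => 1) :
    unitCube (k.insertNth (α := fun _ => ℕ) a i)
        (k.insertNth t x : GridVertex fun _ : Fin (n + 1) => 1) =
      k.insertNth (α := fun _ => ℕ) (if Even a ↔ t = 0 then a else a + 1) (unitCube i x) := by
  funext j
  refine k.succAboveCases ?_ (fun j => ?_) j
  · simp [unitCube]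
  · simp [unitCube]

theorem isMap_insertNth {n : ℕ} (k : Fin (n + 1)) (a : ℕ) :
    IsMap (natGrid n) (natGrid (n + 1)) fun v => k.insertNth (α := fun _ => ℕ) a v := by
  rintro x y ⟨j, hj, hne⟩
  refine Or.inl ⟨k.succAbove j, by simpa using hj, fun l => ?_⟩
  refine k.succAboveCases ?_ (fun l => ?_) l
  · simp
  · intro hl
    simpa using hne l fun e => hl (congrArg _ e)

section BoxChain

variable {V W : Type*} {G : Digraph V} {H : Digraph W} {n : ℕ}

/-- The singular cube obtained by restricting a map on the infinite grid to a unit subcube. -/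
def cubeOf {φ : (Fin n → ℕ) → V} (hφ : IsMap (natGrid n) G φ) (i : Fin n → ℕ) : Cube G n :=
  ⟨fun x => φ (unitCube i x), hφ.comp (unitCube_isMap i)⟩

/-- The box of the `i` with `i k < m k`. -/
abbrev box (m : Fin n → ℕ) : Finset (Fin n → ℕ) := Fintype.piFinset fun k => Finset.range (m k)

theorem mem_box {m i : Fin n → ℕ} : i ∈ box m ↔ ∀ k, i k < m k := by simp [box]

/-- The signed sum of the unit cubes of size `m` of a map on the infinite grid. -/
noncomputable def boxChain (R : Type*) [CommRing R] {φ : (Fin n → ℕ) → V}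
    (hφ : IsMap (natGrid n) G φ) (m : Fin n → ℕ) : Chain R G n :=
  ∑ i ∈ box m, (-1 : R) ^ (∑ k, i k) • Finsupp.single (cubeOf hφ i) (1 : R)

variable (R : Type*) [CommRing R]

/-- The box is sliced into columns parallel to the axis `k`; along each column the contribution of
that axis to the boundary telescopes. -/
theorem sum_box_eq {M : Type*} [AddCommMonoid M] (m : Fin (n + 1) → ℕ) (k : Fin (n + 1))
    (g : (Fin (n + 1) → ℕ) → M) :
    ∑ i ∈ box m, g i = ∑ i ∈ box (k.removeNth m), ∑ a ∈ Finset.range (m k),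
      g (k.insertNth (α := fun _ => ℕ) a i) := by
  rw [Finset.sum_sigma']
  symm
  refine Finset.sum_bij' (fun p _ => k.insertNth (α := fun _ => ℕ) p.2 p.1)
    (fun i _ => ⟨k.removeNth i, i k⟩) ?_ ?_ ?_ ?_ ?_
  · rintro ⟨i, a⟩ h
    simp only [Finset.mem_sigma, mem_box, Finset.mem_range] at h
    rw [mem_box]
    intro j
    refine k.succAboveCases ?_ (fun j => ?_) j
    · simpa using h.2
    · simpa [Fin.removeNth] using h.1 j
  · intro i h
    rw [mem_box] at h
    simp only [Finset.mem_sigma, mem_box, Finset.mem_range]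
    exact ⟨fun j => h _, h _⟩
  · rintro ⟨i, a⟩ h
    simp
  · intro i h
    simp
  · rintro ⟨i, a⟩ h
    rfl

theorem face_cubeOf {φ : (Fin (n + 1) → ℕ) → V} (hφ : IsMap (natGrid (n + 1)) G φ)
    (k : Fin (n + 1)) (a : ℕ) (i : Fin n → ℕ) (t : Fin 2) :
    (cubeOf hφ (k.insertNth (α := fun _ => ℕ) a i)).face k t =
      cubeOf (hφ.comp (isMap_insertNth k (if Even a ↔ t = 0 then a else a + 1))) i :=
  Subtype.ext (funext fun x => congrArg φ (unitCube_insertNth k a i t x))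

/-- The boundary of the chain of a box is the alternating sum of the chains of its faces. -/
theorem bd_boxChain {φ : (Fin (n + 1) → ℕ) → V} (hφ : IsMap (natGrid (n + 1)) G φ)
    (m : Fin (n + 1) → ℕ) :
    bd R G n (boxChain R hφ m) = ∑ k : Fin (n + 1), (-1 : R) ^ ((k : ℕ) + 1) •
      (boxChain R (hφ.comp (isMap_insertNth k 0)) (k.removeNth m) -
        boxChain R (hφ.comp (isMap_insertNth k (m k))) (k.removeNth m)) := by
  unfold boxChain
  simp only [map_sum, map_smul, bd_single, Finset.smul_sum]
  rw [Finset.sum_comm]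
  refine Finset.sum_congr rfl fun k _ => ?_
  rw [sum_box_eq m k, ← Finset.sum_sub_distrib, Finset.smul_sum]
  refine Finset.sum_congr rfl fun i _ => ?_
  -- For odd `a` both the sign `(-1)^a` and the order of the two faces are reversed, so the term is
  -- always the face at `a` minus the face at `a + 1`, with a coefficient independent of `a`.
  have h : ∀ a, (-1 : R) ^ (∑ j, (k.insertNth (α := fun _ => ℕ) a i : Fin (n + 1) → ℕ) j) •
      (-1 : R) ^ ((k : ℕ) + 1) •
        (Finsupp.single ((cubeOf hφ (k.insertNth (α := fun _ => ℕ) a i)).face k 0) (1 : R) -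
          Finsupp.single ((cubeOf hφ (k.insertNth (α := fun _ => ℕ) a i)).face k 1) (1 : R)) =
      (-1 : R) ^ ((k : ℕ) + 1) • (-1 : R) ^ (∑ j, i j) •
        (Finsupp.single (cubeOf (hφ.comp (isMap_insertNth k a)) i) (1 : R) -
          Finsupp.single (cubeOf (hφ.comp (isMap_insertNth k (a + 1))) i) (1 : R)) := by
    intro a
    rw [Fin.sum_univ_succAbove _ k, face_cubeOf, face_cubeOf]
    simp only [Fin.insertNth_apply_same, Fin.insertNth_apply_succAbove, pow_add]
    rcases Nat.even_or_odd a with ha | ha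
    · simp only [ha, ha.neg_one_pow, true_iff, if_true, one_ne_zero, if_false]
      module
    · simp only [Nat.not_even_iff_odd.2 ha, ha.neg_one_pow, false_iff, one_ne_zero, not_true,
        if_true, if_false]
      module
  rw [Finset.sum_congr rfl fun a _ => h a, ← Finset.smul_sum, ← Finset.smul_sum,
    Finset.sum_range_sub', smul_sub]

theorem nbd_mk (x : Chain R G (n + 1)) :
    nbd R G n (NChain.mk R G (n + 1) x) = NChain.mk R G n (bd R G n x) := rfl

theorem single_mem_degenerate (c : Cube G (n + 1)) (i : Fin (n + 1))
    (h : ∀ x y, (∀ j, j ≠ i → x j = y j) → c.1 x = c.1 y) :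
    Finsupp.single c (1 : R) ∈ degenerateChains R G (n + 1) :=
  Submodule.subset_span
    ⟨(c.face i 0, i), congrArg (Finsupp.single · (1 : R)) (c.eq_degenerate i h).symm⟩

/-- Constant cubes of positive dimension are degenerate. In dimension `0` this fails, which is why
`nbd_chain` keeps a constant term. -/
theorem mk_boxChain_eq_zero {φ : (Fin (n + 1) → ℕ) → V} (hφ : IsMap (natGrid (n + 1)) G φ)
    (m : Fin (n + 1) → ℕ) (x : V) (h : ∀ v, φ v = x) :
    NChain.mk R G (n + 1) (boxChain R hφ m) = 0 := by
  rw [NChain.mk_eq_zero]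
  refine Submodule.sum_mem _ fun i _ => Submodule.smul_mem _ _ ?_
  exact single_mem_degenerate R _ 0 fun x y _ => (h _).trans (h _).symm

theorem chainMap_boxChain {f : V → W} (hf : IsMap G H f) {φ : (Fin n → ℕ) → V}
    (hφ : IsMap (natGrid n) G φ) (m : Fin n → ℕ) :
    chainMap R hf n (boxChain R hφ m) = boxChain R (hf.comp hφ) m := by
  simp only [boxChain, map_sum, map_smul, chainMap_single]
  rfl

theorem boxChain_congr {φ ψ : (Fin n → ℕ) → V} (hφ : IsMap (natGrid n) G φ)
    (hψ : IsMap (natGrid n) G ψ) (m : Fin n → ℕ) (h : ∀ v, (∀ k, v k ≤ m k) → φ v = ψ v) :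
    boxChain R hφ m = boxChain R hψ m := by
  refine Finset.sum_congr rfl fun i hi => ?_
  have : cubeOf hφ i = cubeOf hψ i :=
    Subtype.ext (funext fun x => h _ (unitCube_le (mem_box.1 hi) x))
  rw [this]

/-- Even coordinates contribute a factor `1`, so the inversion sign is the product of the
`(-1)^(i_k)`. It therefore factors over the axes and depends only on the parities of the
coordinates. -/
theorem neg_one_pow_card_odd (i : Fin n → ℕ) :
    (-1 : R) ^ (Finset.univ.filter fun k => Odd (i k)).card = (-1) ^ ∑ k, i k := by
  rw [← Finset.prod_pow_eq_pow_sum, ← Finset.prod_const, Finset.prod_filter]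
  refine Finset.prod_congr rfl fun k _ => ?_
  split_ifs with h
  · exact h.neg_one_pow.symm
  · exact (Nat.not_odd_iff_even.1 h).neg_one_pow.symm

/-- The chain of a triple grid map in terms of an extension to the infinite grid. -/
theorem chain_eq_boxChain {P : BasedPair V} [NeZero n] {m : Fin n → ℕ} (f : GridMap P m)
    {φ : (Fin n → ℕ) → V} (hφ : IsMap (natGrid n) P.G φ)
    (h : ∀ v : GridVertex m, φ (fun k => v k) = f.toFun v) :
    f.chain R = NChain.mk R P.G n (boxChain R hφ m) := by
  refine congrArg (NChain.mk R P.G n) ?_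
  refine Finset.sum_bij' (fun i _ k => (i k : ℕ))
    (fun i hi k => ⟨i k, mem_box.1 hi k⟩) ?_ ?_ ?_ ?_ ?_
  · exact fun i _ => mem_box.2 fun k => (i k).2
  · exact fun i _ => Finset.mem_univ _
  · exact fun i _ => rfl
  · exact fun i _ => rfl
  · intro i _
    have h1 : f.cubeAt i = cubeOf hφ fun k => (i k : ℕ) := by
      refine Subtype.ext (funext fun x => ((h _).symm.trans (congrArg φ (funext fun k => ?_))))
      simp only [subcube, unitCube]
      split_ifs <;> rfl
    rw [h1, inversions, neg_one_pow_card_odd]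

end BoxChain

/-! ### Extension of grid maps by clamping -/

section Clamp

variable {n : ℕ}

/-- The retraction of the infinite grid onto a finite one. -/
def clamp (m : Fin n → ℕ) (v : Fin n → ℕ) : GridVertex m :=
  fun k => ⟨min (v k) (m k), Nat.lt_succ_of_le (min_le_right _ _)⟩

theorem clamp_val {m : Fin n → ℕ} (v : GridVertex m) : clamp m (fun k => (v k : ℕ)) = v :=
  funext fun k => Fin.ext (min_eq_left (Nat.le_of_lt_succ (v k).2))

theorem lineAdj_min {a b : ℕ} (c : ℕ) (h : LineAdj a b) :
    LineAdj (min a c) (min b c) ∨ min a c = min b c := by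
  rcases h with ⟨rfl, h⟩ | ⟨rfl, h⟩
  · rcases lt_or_ge a c with h1 | h1
    · rw [min_eq_left h1.le, min_eq_left (by omega)]
      exact Or.inl (Or.inl ⟨rfl, h⟩)
    · exact Or.inr (by omega)
  · rcases lt_or_ge b c with h1 | h1
    · rw [min_eq_left h1.le, min_eq_left (by omega)]
      exact Or.inl (Or.inr ⟨rfl, h⟩)
    · exact Or.inr (by omega)

theorem isMap_pi {m : Fin n → ℕ} (u : ∀ k, ℕ → Fin (m k + 1))
    (hu : ∀ k a b, LineAdj a b → LineAdj (u k a) (u k b) ∨ u k a = u k b) :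
    IsMap (natGrid n) (grid m) fun v k => u k (v k) := by
  rintro v w ⟨k, hk, hne⟩
  rcases hu k _ _ hk with h | h
  · exact Or.inl ⟨k, h, fun j hj => by simp only [hne j hj]⟩
  · refine Or.inr (funext fun j => ?_)
    by_cases hj : j = k
    · subst hj; exact h
    · simp only [hne j hj]

theorem clamp_isMap (m : Fin n → ℕ) : IsMap (natGrid n) (grid m) (clamp m) :=
  isMap_pi (fun k a => ⟨min a (m k), Nat.lt_succ_of_le (min_le_right _ _)⟩) fun k _ _ h =>
    (lineAdj_min (m k) h).imp_right Fin.ext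

variable {V : Type*} {P : BasedPair V} [NeZero n] {m : Fin n → ℕ}

/-- A vertex outside the grid exceeds some `m k`; clamping puts it on the far face of that
coordinate, which belongs to the horn, where `f` is `x₀`. -/
theorem GridMap.extend_eq_clamp (f : GridMap P m) (v : Fin n → ℕ) :
    f.extend v = f.toFun (clamp m v) := by
  unfold GridMap.extend
  split_ifs with h
  · exact congrArg f.toFun (funext fun k => Fin.ext (min_eq_left (h k)).symm)
  · push Not at h
    obtain ⟨k, hk⟩ := h
    refine (f.horn _ ?_).symm
    have hk' : clamp m v k = Fin.last _ := Fin.ext (min_eq_right hk.le)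
    by_cases h0 : k = 0
    · subst h0
      exact Or.inl hk'
    · exact Or.inr ⟨k, h0, Or.inr hk'⟩

theorem GridMap.extend_val (f : GridMap P m) (v : GridVertex m) :
    f.extend (fun k => (v k : ℕ)) = f.toFun v := by
  rw [f.extend_eq_clamp, clamp_val]

theorem GridMap.isMap_extend (f : GridMap P m) : IsMap (natGrid n) P.G f.extend :=
  fun _ _ ⟨k, hk, hne⟩ => f.extend_isMap _ _ k hk hne

end Clamp

/-! ### Invariance under subdivision -/

/-- Digraph maps of the infinite line. -/
def IsLineMap (u : ℕ → ℕ) : Prop :=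
  ∀ ⦃a b⦄, LineAdj a b → LineAdj (u a) (u b) ∨ u a = u b

theorem isMap_coordinatewise {n : ℕ} {u : Fin n → ℕ → ℕ} (hu : ∀ k, IsLineMap (u k)) :
    IsMap (natGrid n) (natGrid n) fun v k => u k (v k) := by
  rintro v w ⟨k, hk, hne⟩
  rcases hu k hk with h | h
  · exact Or.inl ⟨k, h, fun j hj => by simp only [hne j hj]⟩
  · refine Or.inr (funext fun j => ?_)
    by_cases hj : j = k
    · subst hj; exact h
    · simp only [hne j hj]

/-- Arrows point from even to odd numbers. An increasing step must carry the arrow between `a` and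
`a + 1` to an arrow of the same direction, hence has length one and starts at a value of the parity
of `a`. -/
theorem IsLineMap.step {u : ℕ → ℕ} (hu : IsLineMap u) (hm : Monotone u) (a : ℕ) :
    u (a + 1) = u a ∨ (u (a + 1) = u a + 1 ∧ (Even (u a) ↔ Even a)) := by
  have hle : u a ≤ u (a + 1) := hm (Nat.le_add_right a 1)
  rcases Nat.even_or_odd a with ha | ha
  · rcases hu (Or.inl ⟨rfl, ha⟩ : LineAdj a (a + 1)) with (h | h) | h
    · exact Or.inr ⟨h.1, iff_of_true h.2 ha⟩
    · omega
    · exact Or.inl h.symm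
  · rcases hu (Or.inr ⟨rfl, ha⟩ : LineAdj (a + 1) a) with (h | h) | h
    · omega
    · exact Or.inr ⟨h.1, iff_of_false (Nat.not_even_iff_odd.2 h.2) (Nat.not_even_iff_odd.2 ha)⟩
    · exact Or.inl h

/-- A discrete intermediate value theorem: steps have length at most one, so each unit interval
below `u M` is crossed by some step before `M`. -/
theorem IsLineMap.exists_advance {u : ℕ → ℕ} (hu : IsLineMap u) (hm : Monotone u) (h0 : u 0 = 0)
    {M j : ℕ} (hj : j < u M) : ∃ i < M, u i = j ∧ u (i + 1) = u i + 1 := by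
  induction M with
  | zero => omega
  | succ M ih =>
    by_cases h : j < u M
    · obtain ⟨i, hi, h⟩ := ih h
      exact ⟨i, by omega, h⟩
    · refine ⟨M, by omega, ?_⟩
      have := hu.step hm M
      omega

section

variable {R : Type*} [CommRing R] {V : Type*} {G : Digraph V} {n : ℕ}

/-- A cube of the large box is degenerate as soon as one coordinate pauses on it. Where all
coordinates advance, it equals the cube at `u k (i k)`, with the same sign because parities are
preserved; each cube of the small box arises exactly once. -/
theorem mk_boxChain_coordinatewise {φ : (Fin (n + 1) → ℕ) → V} (hφ : IsMap (natGrid (n + 1)) G φ)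
    {u : Fin (n + 1) → ℕ → ℕ} (hu : ∀ k, IsLineMap (u k)) (hm : ∀ k, Monotone (u k))
    (h0 : ∀ k, u k 0 = 0) (M m : Fin (n + 1) → ℕ) (hM : ∀ k, u k (M k) = m k) :
    NChain.mk R G (n + 1) (boxChain R (hφ.comp (isMap_coordinatewise hu)) M) =
      NChain.mk R G (n + 1) (boxChain R hφ m) := by
  unfold boxChain
  rw [map_sum, map_sum,
    ← Finset.sum_filter_of_ne (p := fun i => ∀ k, u k (i k + 1) = u k (i k) + 1)]
  · refine Finset.sum_nbij (fun i k => u k (i k)) ?_ ?_ ?_ ?_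
    · intro i hi
      obtain ⟨hi, h⟩ := Finset.mem_filter.1 hi
      refine mem_box.2 fun k => ?_
      have h1 := hm k (Nat.succ_le_of_lt (mem_box.1 hi k))
      rw [hM, Nat.succ_eq_add_one, h k] at h1
      omega
    · intro i hi j hj hij
      have h1 := (Finset.mem_filter.1 hi).2
      have h2 := (Finset.mem_filter.1 hj).2
      funext k
      have h3 := congrFun hij k
      have h4 := h1 k
      have h5 := h2 k
      simp only at h3
      -- Injectivity: if both positions are advances and one precedes the other, monotonicity makes
      -- the later value strictly larger.
      rcases lt_trichotomy (i k) (j k) with h | h | h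
      · have := hm k (Nat.succ_le_of_lt h)
        rw [Nat.succ_eq_add_one] at this
        omega
      · exact h
      · have := hm k (Nat.succ_le_of_lt h)
        rw [Nat.succ_eq_add_one] at this
        omega
    · intro j hj
      have hj' : ∀ k, j k < u k (M k) := fun k => (hM k).symm ▸ mem_box.1 hj k
      choose i hi h1 h2 using fun k => (hu k).exists_advance (hm k) (h0 k) (hj' k)
      exact ⟨i, Finset.mem_coe.2 (Finset.mem_filter.2 ⟨mem_box.2 hi, h2⟩), funext h1⟩
    · intro i hi
      have h := (Finset.mem_filter.1 hi).2
      have hp : ∀ k, Even (u k (i k)) ↔ Even (i k) := fun k =>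
        ((hu k).step (hm k) (i k)).elim (fun e => by have := h k; omega) fun e => e.2
      have h1 : cubeOf (hφ.comp (isMap_coordinatewise hu)) i = cubeOf hφ fun k => u k (i k) := by
        refine Subtype.ext (funext fun x => congrArg φ (funext fun k => ?_))
        simp only [unitCube, hp]
        split_ifs
        · rfl
        · exact h k
      have h2 : (-1 : R) ^ (∑ k, i k) = (-1) ^ ∑ k, u k (i k) := by
        rw [← Finset.prod_pow_eq_pow_sum, ← Finset.prod_pow_eq_pow_sum]
        exact Finset.prod_congr rfl fun k _ => neg_one_pow_congr (hp k).symm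
      rw [h1, h2]
  · intro i _ hne
    by_contra hcon
    push Not at hcon
    obtain ⟨k, hk⟩ := hcon
    have hk' : u k (i k + 1) = u k (i k) :=
      ((hu k).step (hm k) (i k)).resolve_right fun e => hk e.1
    refine hne ?_
    rw [NChain.mk_eq_zero]
    -- The coordinate `k` pauses between `i k` and `i k + 1`, so the cube does not depend on it.
    refine Submodule.smul_mem _ _ (single_mem_degenerate R _ k fun x y hxy => ?_)
    refine congrArg φ (funext fun j => ?_)
    by_cases hj : j = k
    · subst hj
      simp only [unitCube]
      split_ifs <;> simp [hk']
    · simp only [unitCube, hxy j hj]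

end

/-- A shrinking map, extended to the infinite line by a constant. -/
def extendLine {M m : ℕ} (h : Fin (M + 1) → Fin (m + 1)) (a : ℕ) : ℕ :=
  h ⟨min a M, Nat.lt_succ_of_le (min_le_right _ _)⟩

section

variable {M m : ℕ} {h : Fin (M + 1) → Fin (m + 1)}

theorem IsShrinking.isLineMap (hh : IsShrinking h) : IsLineMap (extendLine h) := by
  intro a b hab
  rcases lineAdj_min M hab with e | e
  · rcases hh.isMap (v := ⟨min a M, Nat.lt_succ_of_le (min_le_right _ _)⟩)
      (w := ⟨min b M, Nat.lt_succ_of_le (min_le_right _ _)⟩) e with h1 | h1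
    · exact Or.inl h1
    · exact Or.inr (congrArg Fin.val h1)
  · exact Or.inr (by simp only [extendLine, e])

theorem IsShrinking.extendLine_monotone (hh : IsShrinking h) : Monotone (extendLine h) :=
  fun _ _ hab => hh.monotone (Fin.mk_le_mk.2 (min_le_min_right _ hab))

theorem IsShrinking.extendLine_zero (hh : IsShrinking h) : extendLine h 0 = 0 := by
  have : (⟨min 0 M, Nat.lt_succ_of_le (min_le_right _ _)⟩ : Fin (M + 1)) = 0 :=
    Fin.ext (Nat.zero_min M)
  rw [extendLine, this, hh.map_zero, Fin.val_zero]

theorem IsShrinking.extendLine_of_ge (hh : IsShrinking h) {a : ℕ} (ha : M ≤ a) :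
    extendLine h a = m := by
  have : (⟨min a M, Nat.lt_succ_of_le (min_le_right _ _)⟩ : Fin (M + 1)) = Fin.last M :=
    Fin.ext (min_eq_right ha)
  rw [extendLine, this, hh.map_last, Fin.val_last]

end

section

variable (R : Type*) [CommRing R] {V : Type*} {P : BasedPair V} {n : ℕ}

theorem GridMap.extend_subdivide [NeZero n] {m M : Fin n → ℕ} (f : GridMap P m)
    (h : Shrinking M m) (v : Fin n → ℕ) :
    (f.subdivide h).extend v = f.extend fun k => extendLine (h.toFun k) (v k) := by
  rw [GridMap.extend_eq_clamp, GridMap.extend_eq_clamp]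
  refine congrArg f.toFun (funext fun k => Fin.ext ?_)
  exact (min_eq_left (Nat.le_of_lt_succ (h.toFun k _).2)).symm

theorem chain_eq_extend [NeZero n] {m : Fin n → ℕ} (f : GridMap P m) :
    f.chain R = NChain.mk R P.G n (boxChain R f.isMap_extend m) :=
  chain_eq_boxChain R f _ f.extend_val

theorem chain_subdivide {m M : Fin (n + 1) → ℕ} (f : GridMap P m) (h : Shrinking M m) :
    (f.subdivide h).chain R = f.chain R := by
  rw [chain_eq_extend, chain_eq_extend, ← mk_boxChain_coordinatewise f.isMap_extend
    (fun k => (h.shrinks k).isLineMap) (fun k => (h.shrinks k).extendLine_monotone)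
    (fun k => (h.shrinks k).extendLine_zero) M m
    (fun k => (h.shrinks k).extendLine_of_ge le_rfl)]
  exact congrArg _ (boxChain_congr R _ _ M fun v _ => f.extend_subdivide h v)

end

/-! ### The boundary of the chain of a grid map -/

section

variable (R : Type*) [CommRing R] {V : Type*} {P : BasedPair V} {n : ℕ}

/-- The face `v 0 = 0` of the extension of a grid map to the infinite grid. -/
def GridMap.extendFace {m : Fin (n + 1) → ℕ} (f : GridMap P m) (v : Fin n → ℕ) : P.A.verts :=
  ⟨f.extend ((0 : Fin (n + 1)).insertNth (α := fun _ => ℕ) 0 v), f.extend_mem _ (by simp)⟩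

theorem GridMap.isMap_extendFace {m : Fin (n + 1) → ℕ} (f : GridMap P m) :
    IsMap (natGrid n) P.A.coe f.extendFace := by
  intro v w hvw
  rcases isMap_insertNth 0 0 hvw with ⟨k, hk, hne⟩ | h
  · rcases f.extend_mapsInto _ _ (by simp) (by simp) k hk hne with h | h
    · exact Or.inl h
    · exact Or.inr (Subtype.ext h)
  · exact Or.inr (Subtype.ext (congrArg f.extend h))

theorem isMap_const {U W : Type*} (F : Digraph U) (G : Digraph W) (x : W) :
    IsMap F G fun _ => x := fun _ _ _ => Or.inr rfl

theorem incl_mk_boxChain {G : Digraph V} {A : Subdigraph G} {φ : (Fin n → ℕ) → A.verts}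
    (hφ : IsMap (natGrid n) A.coe φ) (m : Fin n → ℕ) :
    incl R A n (NChain.mk R A.coe n (boxChain R hφ m)) =
      NChain.mk R G n (boxChain R (A.isMap_val.comp hφ) m) :=
  congrArg (NChain.mk R G n) (chainMap_boxChain R A.isMap_val hφ m)

/-- Only the two faces of the first axis can survive, with coefficient `(-1)^(0+1)`, the source of
the minus sign. All faces of the other axes lie in the horn and are degenerate, since other axes
exist only when `n ≥ 1`. The face `v 0 = m 0` is constant too, but for `n = 0` it is a point and
cannot be dropped. -/
theorem nbd_chain {m : Fin (n + 1) → ℕ} (f : GridMap P m) :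
    nbd R P.G n (f.chain R) = -incl R P.A n
      (NChain.mk R P.A.coe n (boxChain R f.isMap_extendFace fun k => m k.succ) -
        NChain.mk R P.A.coe n
          (boxChain R (isMap_const (natGrid n) P.A.coe ⟨P.x₀, P.mem⟩) fun k => m k.succ)) := by
  have hx : ∀ k : Fin (n + 1), ∀ v : Fin n → ℕ,
      f.extend (k.insertNth (α := fun _ => ℕ) (m k) v) = P.x₀ := fun k v =>
    f.extend_horn _ (Or.inl ⟨k, by simp⟩)
  rw [chain_eq_extend, nbd_mk, bd_boxChain, map_sum, Fin.sum_univ_succ, Finset.sum_eq_zero,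
    add_zero, map_sub, incl_mk_boxChain, incl_mk_boxChain, map_smul, map_sub]
  · rw [Fin.val_zero, zero_add, pow_one, neg_one_smul]
    congr 3
    refine boxChain_congr R _ _ _ fun v _ => hx 0 v
  · intro k _
    cases n with
    | zero => exact k.elim0
    | succ n =>
      rw [map_smul, map_sub, mk_boxChain_eq_zero R _ _ P.x₀ (hx k.succ),
        mk_boxChain_eq_zero R _ _ P.x₀, sub_self, smul_zero]
      exact fun v => f.extend_horn _ (Or.inr ⟨k.succ, Fin.succ_ne_zero k, by simp⟩)

theorem relBd_relChain {m : Fin (n + 1) → ℕ} (f : GridMap P m) :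
    relBd R P.A n (f.relChain R) = 0 := by
  refine (QuotTerm.mk_eq_zero (incl R P.A) n (nbd R P.G n (f.chain R))).2 ?_
  rw [nbd_chain, ← map_neg]
  exact ⟨_, rfl⟩

/-- Here the subdigraph is a single point, so the face `v 0 = 0` is constant as well and cancels the
opposite one, even when the faces are points. -/
theorem nbd_chain_sub {m : Fin (n + 1) → ℕ} (f : GridMap P.sub m) :
    nbd R P.A.coe n (f.chain R) = 0 := by
  refine (nbd_chain R f).trans ?_
  rw [boxChain_congr R f.isMap_extendFace
    (isMap_const (natGrid n) P.sub.A.coe ⟨P.sub.x₀, P.sub.mem⟩) _ fun v _ =>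
      Subtype.ext (f.extendFace v).2, sub_self, map_zero]
  exact neg_zero

/-- The remaining face has positive dimension, so the constant term of `nbd_chain` is degenerate.
This identity at chain level is the compatibility with the connecting homomorphism, sign included.
-/
theorem nbd_chain_eq_face {m : Fin (n + 2) → ℕ} (f : GridMap P m) :
    nbd R P.G (n + 1) (f.chain R) = incl R P.A (n + 1) (-f.face.chain R) := by
  have h : (f.face.chain R : NChain R P.A.coe (n + 1)) =
      NChain.mk R P.A.coe (n + 1) (boxChain R f.isMap_extendFace fun k => m k.succ) := by
    refine chain_eq_boxChain R f.face _ fun v => Subtype.ext ?_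
    change f.extend _ = f.toFun _
    rw [← f.extend_val]
    refine congrArg f.extend (funext fun k => ?_)
    refine Fin.cases ?_ (fun k => ?_) k
    · simp
    · simp [Fin.insertNth_zero']
  rw [nbd_chain, mk_boxChain_eq_zero R (isMap_const _ _ _) _ _ fun _ => rfl, sub_zero]
  exact (map_neg (incl R P.A (n + 1)) _).symm.trans
    (congrArg (fun x => incl R P.A (n + 1) (-x)) h.symm)

end

/-! ### Homotopy invariance -/

section

variable (R : Type*) [CommRing R] {V : Type*} {P : BasedPair V} {n : ℕ}

/-- The retraction of the infinite grid onto the prism over a grid. -/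
def clampPrism (M : Fin n → ℕ) (v : Fin (n + 1) → ℕ) : GridVertex M × Fin 2 :=
  (clamp M fun k => v k.succ, ⟨min (v 0) 1, Nat.lt_succ_of_le (min_le_right _ _)⟩)

theorem clampPrism_insertNth (M : Fin n → ℕ) (t : ℕ) (v : Fin n → ℕ) :
    clampPrism M ((0 : Fin (n + 1)).insertNth (α := fun _ => ℕ) t v) =
      (clamp M v, ⟨min t 1, Nat.lt_succ_of_le (min_le_right _ _)⟩) := by
  simp [clampPrism, Fin.insertNth_zero']

/-- Coordinate `0` is the time of a homotopy and the others are space, so an arrow moves only one of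
the two. Clamping keeps it an arrow of the prism or collapses it. -/
theorem clampPrism_adj (M : Fin n → ℕ) {v w : Fin (n + 1) → ℕ} (h : (natGrid (n + 1)).Adj v w) :
    ((clampPrism M v).1 = (clampPrism M w).1 ∧
        (line 1).Adj (clampPrism M v).2 (clampPrism M w).2) ∨
      ((grid M).Adj (clampPrism M v).1 (clampPrism M w).1 ∧
        (clampPrism M v).2 = (clampPrism M w).2) ∨ clampPrism M v = clampPrism M w := by
  obtain ⟨k, hk, hne⟩ := h
  revert hk hne
  refine Fin.cases (fun hk hne => ?_) (fun k hk hne => ?_) k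
  · have h1 : (clampPrism M v).1 = (clampPrism M w).1 :=
      congrArg (clamp M) (funext fun j => hne _ (Fin.succ_ne_zero j))
    rcases lineAdj_min 1 hk with h2 | h2
    · exact Or.inl ⟨h1, h2⟩
    · exact Or.inr (Or.inr (Prod.ext h1 (Fin.ext h2)))
  · have h1 : (clampPrism M v).2 = (clampPrism M w).2 :=
      Fin.ext (congrArg (min · 1) (hne 0 (Fin.succ_ne_zero k).symm))
    rcases clamp_isMap M (v := fun j => v j.succ) (w := fun j => w j.succ)
      ⟨k, hk, fun j hj => hne _ fun e => hj (Fin.succ_injective _ e)⟩ with h2 | h2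
    · exact Or.inr (Or.inl ⟨h2, h1⟩)
    · exact Or.inr (Or.inr (Prod.ext h2 h1))

/-- The homotopy is a map of a prism. Its time faces are `f` and `g`, its face over the first
spatial coordinate `0` is the map `θ` into `A`, and its other faces are constant. The error term is
given as the chain of a map, not as an arbitrary chain of `A`: when `A` is a point, `θ` is constant
and its chain vanishes, which settles the absolute case. -/
theorem DirectHomotopic.chain_sub_eq {M : Fin (n + 1) → ℕ} {f g : GridMap P M}
    (h : DirectHomotopic f g) :
    ∃ (K : NChain R P.G (n + 2)) (θ : (Fin (n + 1) → ℕ) → P.A.verts)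
      (hθ : IsMap (natGrid (n + 1)) P.A.coe θ) (l : Fin (n + 1) → ℕ),
      f.chain R - g.chain R = nbd R P.G (n + 1) K +
        incl R P.A (n + 1) (NChain.mk R P.A.coe (n + 1) (boxChain R hθ l)) := by
  obtain ⟨F, hF, hA, hx, h0, h1⟩ := h
  have hΦ : IsMap (natGrid (n + 2)) P.G fun v => F (clampPrism M v) := by
    intro v w hvw
    rcases clampPrism_adj M hvw with e | e | e
    · exact hF (Or.inl e)
    · exact hF (Or.inr e)
    · exact Or.inr (congrArg F e)
  have hend : ∀ v : Fin (n + 1) → ℕ, IsEnd ((clampPrism M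
      ((1 : Fin (n + 2)).insertNth (α := fun _ => ℕ) 0 v)).1 0) := by
    intro v
    refine Or.inl (Fin.ext ?_)
    change min ((1 : Fin (n + 2)).insertNth (α := fun _ => ℕ) 0 v (Fin.succ 0)) (M 0) = 0
    rw [Fin.succ_zero_eq_one, Fin.insertNth_apply_same, Nat.zero_min]
  let θ : (Fin (n + 1) → ℕ) → P.A.verts := fun v =>
    ⟨F (clampPrism M ((1 : Fin (n + 2)).insertNth (α := fun _ => ℕ) 0 v)),
      hA.1 _ ⟨0, hend v⟩⟩
  have hend' : ∀ v w, (clampPrism M ((1 : Fin (n + 2)).insertNth (α := fun _ => ℕ) 0 v)).1 0 =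
      (clampPrism M ((1 : Fin (n + 2)).insertNth (α := fun _ => ℕ) 0 w)).1 0 := by
    intro v w
    refine Fin.ext ?_
    change min ((1 : Fin (n + 2)).insertNth (α := fun _ => ℕ) 0 v (Fin.succ 0)) (M 0) =
      min ((1 : Fin (n + 2)).insertNth (α := fun _ => ℕ) 0 w (Fin.succ 0)) (M 0)
    rw [Fin.succ_zero_eq_one, Fin.insertNth_apply_same, Fin.insertNth_apply_same]
  have hθ : IsMap (natGrid (n + 1)) P.A.coe θ := by
    intro v w hvw
    have key : P.A.Adj (θ v).1 (θ w).1 ∨ (θ v).1 = (θ w).1 := by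
      rcases isMap_insertNth (1 : Fin (n + 2)) 0 hvw with e | e
      · rcases clampPrism_adj M e with e | e | e
        · exact hA.2 (Or.inl ⟨e.1, ⟨0, hend v⟩, e.2⟩)
        · exact hA.2 (Or.inr ⟨⟨e.1, 0, hend v, hend' v w⟩, e.2⟩)
        · exact Or.inr (congrArg F e)
      · exact Or.inr (congrArg (fun p => F (clampPrism M p)) e)
    exact key.imp_right Subtype.ext
  have hlast : ∀ (k : Fin (n + 1)) v, F (clampPrism M
      (k.succ.insertNth (α := fun _ => ℕ) (M k) v)) = P.x₀ := by
    intro k v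
    have e : (clampPrism M (k.succ.insertNth (α := fun _ => ℕ) (M k) v)).1 k = Fin.last _ := by
      refine Fin.ext ?_
      change min (k.succ.insertNth (α := fun _ => ℕ) (M k) v k.succ) (M k) = M k
      rw [Fin.insertNth_apply_same, min_self]
    refine hx _ ?_ _
    by_cases h0 : k = 0
    · subst h0
      exact Or.inl e
    · exact Or.inr ⟨k, h0, Or.inr e⟩
  have hfirst : ∀ (k : Fin n) v, F (clampPrism M
      (k.succ.succ.insertNth (α := fun _ => ℕ) 0 v)) = P.x₀ := by
    intro k v
    refine hx _ (Or.inr ⟨k.succ, Fin.succ_ne_zero k, Or.inl (Fin.ext ?_)⟩) _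
    change min (k.succ.succ.insertNth (α := fun _ => ℕ) 0 v k.succ.succ) _ = 0
    rw [Fin.insertNth_apply_same, Nat.zero_min]
  -- The prism has length one in the time direction.
  let l : Fin (n + 2) → ℕ := Fin.cons 1 M
  have hf : NChain.mk R P.G (n + 1) (boxChain R (hΦ.comp (isMap_insertNth 0 0))
      ((0 : Fin (n + 2)).removeNth l)) = f.chain R :=
    (chain_eq_boxChain R f _ fun v => (congrArg F ((clampPrism_insertNth M 0 _).trans
      (congrArg (fun a => (a, (0 : Fin 2))) (clamp_val v)))).trans (h0 v)).symm
  have hg : NChain.mk R P.G (n + 1) (boxChain R (hΦ.comp (isMap_insertNth 0 (l 0)))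
      ((0 : Fin (n + 2)).removeNth l)) = g.chain R :=
    (chain_eq_boxChain R g _ fun v => (congrArg F ((clampPrism_insertNth M 1 _).trans
      (congrArg (fun a => (a, (1 : Fin 2))) (clamp_val v)))).trans (h1 v)).symm
  have hL : ∀ k : Fin (n + 1), NChain.mk R P.G (n + 1) (boxChain R
      (hΦ.comp (isMap_insertNth k.succ (l k.succ))) (k.succ.removeNth l)) = 0 := fun k =>
    mk_boxChain_eq_zero R _ _ P.x₀ (hlast k)
  have hF : ∀ k : Fin n, NChain.mk R P.G (n + 1) (boxChain R
      (hΦ.comp (isMap_insertNth k.succ.succ 0)) (k.succ.succ.removeNth l)) = 0 := fun k =>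
    mk_boxChain_eq_zero R _ _ P.x₀ (hfirst k)
  -- The time axis enters the boundary with sign `-1` and the next axis with `+1`, so the prism has
  -- boundary `-(f - g) + θ` on chains; negating it gives the stated equation.
  refine ⟨-NChain.mk R P.G (n + 2) (boxChain R hΦ l), θ, hθ, (1 : Fin (n + 2)).removeNth l, ?_⟩
  rw [map_neg, nbd_mk, bd_boxChain, map_sum, Fin.sum_univ_succ, Fin.sum_univ_succ,
    Finset.sum_eq_zero, add_zero]
  · rw [map_smul, map_smul, map_sub, map_sub, hf, hg, incl_mk_boxChain, hL]
    have e : (NChain.mk R P.G (n + 1)) (boxChain R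
        (hΦ.comp (isMap_insertNth (Fin.succ 0 : Fin (n + 2)) 0)) ((Fin.succ 0).removeNth l)) =
        (NChain.mk R P.G (n + 1)) (boxChain R (P.A.isMap_val.comp hθ)
          ((1 : Fin (n + 2)).removeNth l)) := rfl
    rw [e]
    simp only [Fin.val_zero, Fin.val_succ]
    module
  · intro k _
    rw [map_smul, map_sub, hL, hF, sub_self, smul_zero]

theorem OneStep.exists_chain_sub_eq {f g : AnyGridMap P (n + 1)} (h : OneStep P (n + 1) f g) :
    ∃ (K : NChain R P.G (n + 2)) (θ : (Fin (n + 1) → ℕ) → P.A.verts)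
      (hθ : IsMap (natGrid (n + 1)) P.A.coe θ) (l : Fin (n + 1) → ℕ),
      f.2.chain R - g.2.chain R = nbd R P.G (n + 1) K +
        incl R P.A (n + 1) (NChain.mk R P.A.coe (n + 1) (boxChain R hθ l)) := by
  obtain ⟨M, h, h', hd⟩ := h
  obtain ⟨K, θ, hθ, l, e⟩ := hd.chain_sub_eq R
  rw [chain_subdivide, chain_subdivide] at e
  exact ⟨K, θ, hθ, l, e⟩

/-- An assignment constant along one-step homotopies induces a map on homotopy sets. -/
theorem FHomotopic.eq_of_oneStep {X : Type*} [NeZero n] (T : AnyGridMap P n → X)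
    (hT : ∀ f g, OneStep P n f g → T f = T g) {f g : AnyGridMap P n} (h : FHomotopic P n f g) :
    T f = T g := by
  induction h with
  | rel f g h => exact hT f g h
  | refl f => rfl
  | symm f g _ ih => exact ih.symm
  | trans f g k _ _ ih₁ ih₂ => exact ih₁.trans ih₂

theorem homologyMk_eq {M : ℕ → Type*} [∀ n, AddCommGroup (M n)] [∀ n, Module R (M n)]
    (d : ∀ n, M (n + 1) →ₗ[R] M n) (n : ℕ) {z w : M n} (hz : outgoing d n z = 0)
    (hw : outgoing d n w = 0) (y : M (n + 1)) (h : z - w = d n y) :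
    Homology.mk d n z hz = Homology.mk d n w hw :=
  (Submodule.Quotient.eq _).2 ⟨y, h.symm⟩

theorem OneStep.homologyMk_relChain_eq {f g : AnyGridMap P (n + 1)} (h : OneStep P (n + 1) f g) :
    Homology.mk (relBd R P.A) (n + 1) (f.2.relChain R) (relBd_relChain R f.2) =
      Homology.mk (relBd R P.A) (n + 1) (g.2.relChain R) (relBd_relChain R g.2) := by
  obtain ⟨K, θ, hθ, l, e⟩ := h.exists_chain_sub_eq R
  refine homologyMk_eq R _ _ _ _ (QuotTerm.mk (incl R P.A) (n + 2) K) ?_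
  change _ = QuotTerm.mk (incl R P.A) (n + 1) (nbd R P.G (n + 1) K)
  unfold GridMap.relChain
  rw [← map_sub, e, map_add, (QuotTerm.mk_eq_zero (incl R P.A) (n + 1) (incl R P.A _ _)).2
    ⟨_, rfl⟩, add_zero]

theorem OneStep.homologyMk_chain_eq {f g : AnyGridMap P.sub (n + 1)}
    (h : OneStep P.sub (n + 1) f g) :
    Homology.mk (nbd R P.A.coe) (n + 1) (f.2.chain R) (nbd_chain_sub R f.2) =
      Homology.mk (nbd R P.A.coe) (n + 1) (g.2.chain R) (nbd_chain_sub R g.2) := by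
  obtain ⟨K, θ, hθ, l, e⟩ := h.exists_chain_sub_eq R
  rw [mk_boxChain_eq_zero R hθ l ⟨_, rfl⟩ fun v => Subtype.ext (θ v).2, map_zero, add_zero] at e
  exact homologyMk_eq R _ _ _ _ K e

/-- The Hurewicz map of a pair. -/
noncomputable def relHurewicz (P : BasedPair V) (n : ℕ) :
    HomotopySet P (n + 1) → RelHomology R P.A (n + 1) :=
  Quot.lift (fun f => Homology.mk (relBd R P.A) (n + 1) (f.2.relChain R) (relBd_relChain R f.2))
    fun _ _ => FHomotopic.eq_of_oneStep _ fun _ _ h => h.homologyMk_relChain_eq R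

/-- The Hurewicz map of a subdigraph. -/
noncomputable def absHurewicz (P : BasedPair V) (n : ℕ) :
    HomotopySet P.sub (n + 1) → CubicalHomology R P.A.coe (n + 1) :=
  Quot.lift (fun f => Homology.mk (nbd R P.A.coe) (n + 1) (f.2.chain R) (nbd_chain_sub R f.2))
    fun _ _ => FHomotopic.eq_of_oneStep _ fun _ _ h => h.homologyMk_chain_eq R

theorem HomotopySet.exists_rep [NeZero n] (x : HomotopySet P n) :
    ∃ (m : Fin n → ℕ) (f : GridMap P m), HomotopySet.mk f = x := by
  obtain ⟨⟨m, f⟩, rfl⟩ := Quot.exists_rep x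
  exact ⟨m, f, rfl⟩

theorem relHomologyMap_relHurewicz {W : Type*} {Q : BasedPair W} (φ : P.Hom Q)
    (x : HomotopySet P (n + 1)) :
    relHomologyMap R φ (n + 1) (relHurewicz R P n x) =
      relHurewicz R Q n (HomotopySet.map φ (n + 1) x) := by
  obtain ⟨m, f, rfl⟩ := x.exists_rep
  have h : nmap R φ.isMap (n + 1) (f.chain R) = (f.comp φ).chain R := by
    rw [chain_eq_extend, chain_eq_boxChain R (f.comp φ) (φ.isMap.comp f.isMap_extend)
      fun v => congrArg φ.toFun (f.extend_val v),
      ← chainMap_boxChain R φ.isMap f.isMap_extend]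
    rfl
  have h' : relMap R φ.isMap φ.mapsInto (n + 1) (f.relChain R) = (f.comp φ).relChain R :=
    congrArg (QuotTerm.mk (incl R Q.A) (n + 1)) h
  exact homologyMk_eq R (relBd R Q.A) (n + 1) _ (relBd_relChain R (f.comp φ)) 0
    ((sub_eq_zero.2 h').trans (map_zero _).symm)

/-- The absolute chain of `f` is an explicit lift of the relative cycle, and `nbd_chain_eq_face`
identifies its boundary as the image of minus the chain of the face. -/
theorem relConnecting_relHurewicz (x : HomotopySet P (n + 2)) :
    relConnecting R P.A (n + 1) (relHurewicz R P (n + 1) x) =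
      -absHurewicz R P n (HomotopySet.boundary P n x) := by
  obtain ⟨m, f, rfl⟩ := x.exists_rep
  exact connecting_mk (incl R P.A) (nmap_nbd R P.A.isMap_val) (incl_injective R P.A)
    (nbd_nbd R P.G) (n + 1) (f.chain R) (-f.face.chain R) (nbd_chain_eq_face R f).symm
    (relBd_relChain R f)

end

/-! ### Stable grid maps -/

theorem isMap_update {n : ℕ} {u : ℕ → ℕ} (hu : IsLineMap u) (k : Fin n) :
    IsMap (natGrid n) (natGrid n) fun v => Function.update v k (u (v k)) := by
  rintro v w ⟨j, hj, hne⟩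
  by_cases h : j = k
  · subst h
    rcases hu hj with h1 | h1
    · refine Or.inl ⟨j, by simpa using h1, fun i hi => ?_⟩
      simpa only [Function.update_of_ne hi] using hne i hi
    · refine Or.inr (funext fun i => ?_)
      by_cases hi : i = j
      · subst hi; simpa using h1
      · simpa only [Function.update_of_ne hi] using hne i hi
  · refine Or.inl ⟨j, by simpa only [Function.update_of_ne h] using hj, fun i hi => ?_⟩
    by_cases hik : i = k
    · subst hik; simp [hne i hi]
    · simpa only [Function.update_of_ne hik] using hne i hi

/-- Triple grid maps on the infinite grid that are constant outside of a bounded region. -/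
@[ext]
structure StableMap {V : Type*} (P : BasedPair V) (n : ℕ) [NeZero n] where
  toFun : (Fin n → ℕ) → V
  isMap : IsMap (natGrid n) P.G toFun
  mem : ∀ v, v 0 = 0 → toFun v ∈ P.A.verts
  mapsInto : ∀ v w, (natGrid n).Adj v w → v 0 = 0 → w 0 = 0 →
    P.A.Adj (toFun v) (toFun w) ∨ toFun v = toFun w
  zero : ∀ v k, k ≠ 0 → v k = 0 → toFun v = P.x₀
  bounded : ∃ N, ∀ v k, N ≤ v k → toFun v = P.x₀

namespace StableMap

section

variable {V : Type*} {P : BasedPair V} {n : ℕ} [NeZero n]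

/-- Direct homotopies of stable grid maps. -/
def Step (F G : StableMap P n) : Prop :=
  (∀ v, P.G.Adj (F.toFun v) (G.toFun v) ∨ F.toFun v = G.toFun v) ∧
    ∀ v, v 0 = 0 → P.A.Adj (F.toFun v) (G.toFun v) ∨ F.toFun v = G.toFun v

end

/-- Homotopy classes of stable grid maps. -/
abbrev Classes {V : Type*} (P : BasedPair V) (n : ℕ) [NeZero n] : Type _ :=
  Quot (Step (P := P) (n := n))

section

variable {V : Type*} {P : BasedPair V} {n : ℕ} [NeZero n]

/-- The homotopy class of a stable grid map. -/
abbrev cls (F : StableMap P n) : Classes P n := Quot.mk _ F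

/-! ### Reparametrization of one coordinate -/

/-- The conditions under which reparametrizing the coordinate `k` by `u` is possible. -/
structure Admissible (F : StableMap P n) (k : Fin n) (u : ℕ → ℕ) : Prop where
  isLineMap : IsLineMap u
  -- The second alternative allows reversals, which start where `F` is already `x₀`. It is excluded
  -- for coordinate `0`, whose zero face must be carried to itself.
  zero : u 0 = 0 ∨ (k ≠ 0 ∧ ∀ v, v k = u 0 → F.toFun v = P.x₀)
  bounded : ∃ N, ∀ a, N ≤ a → ∀ v, v k = u a → F.toFun v = P.x₀

theorem Admissible.update_zero {F : StableMap P n} {k : Fin n} {u : ℕ → ℕ}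
    (h : F.Admissible k u) (v : Fin n → ℕ) (hv : v 0 = 0) :
    Function.update v k (u (v k)) 0 = 0 := by
  by_cases hk : 0 = k
  · subst hk
    rw [Function.update_self, hv]
    exact h.zero.resolve_right fun e => e.1 rfl
  · rwa [Function.update_of_ne hk]

/-- Reparametrization of the coordinate `k`. -/
def reparam (F : StableMap P n) (k : Fin n) (u : ℕ → ℕ) (h : F.Admissible k u) :
    StableMap P n where
  toFun v := F.toFun (Function.update v k (u (v k)))
  isMap := F.isMap.comp (isMap_update h.isLineMap k)
  mem v hv := F.mem _ (h.update_zero v hv)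
  mapsInto v w hvw hv hw := by
    rcases isMap_update h.isLineMap k hvw with e | e
    · exact F.mapsInto _ _ e (h.update_zero v hv) (h.update_zero w hw)
    · exact Or.inr (congrArg F.toFun e)
  zero v j hj hv := by
    by_cases hjk : j = k
    · subst hjk
      rcases h.zero with e | e
      · exact F.zero _ j hj (by rw [Function.update_self, hv, e])
      · exact e.2 _ (by rw [Function.update_self, hv])
    · exact F.zero _ j hj (by rwa [Function.update_of_ne hjk])
  bounded := by
    obtain ⟨N, hN⟩ := h.bounded
    obtain ⟨B, hB⟩ := F.bounded
    refine ⟨max N B, fun v j hj => ?_⟩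
    by_cases hjk : j = k
    · subst hjk
      exact hN _ ((le_max_left _ _).trans hj) _ (Function.update_self ..)
    · exact hB _ j (by rw [Function.update_of_ne hjk]; exact (le_max_right _ _).trans hj)

theorem step_reparam (F : StableMap P n) (k : Fin n) {u u' : ℕ → ℕ} (h : F.Admissible k u)
    (h' : F.Admissible k u') (huu : ∀ a, u a = u' a ∨ LineAdj (u a) (u' a)) :
    Step (F.reparam k u h) (F.reparam k u' h') := by
  have key : ∀ v : Fin n → ℕ, Function.update v k (u (v k)) = Function.update v k (u' (v k)) ∨
      (natGrid n).Adj (Function.update v k (u (v k))) (Function.update v k (u' (v k))) := by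
    intro v
    rcases huu (v k) with e | e
    · exact Or.inl (by rw [e])
    · refine Or.inr ⟨k, by simpa using e, fun j hj => ?_⟩
      rw [Function.update_of_ne hj, Function.update_of_ne hj]
  refine ⟨fun v => ?_, fun v hv => ?_⟩
  · rcases key v with e | e
    · exact Or.inr (congrArg F.toFun e)
    · exact F.isMap e
  · rcases key v with e | e
    · exact Or.inr (congrArg F.toFun e)
    · exact F.mapsInto _ _ e (h.update_zero v hv) (h'.update_zero v hv)

/-- Reparametrizations in a family changing from `t` to `t + 1` at time `t` are homotopic. -/
theorem cls_reparam_path (F : StableMap P n) (k : Fin n) (u : ℕ → ℕ → ℕ)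
    (h : ∀ t, F.Admissible k (u t))
    (hs : ∀ t a, u t a = u (t + 1) a ∨ (u t a = t ∧ u (t + 1) a = t + 1)) (t : ℕ) :
    cls (F.reparam k (u 0) (h 0)) = cls (F.reparam k (u t) (h t)) := by
  induction t with
  | zero => rfl
  | succ t ih =>
    refine ih.trans ?_
    -- The arrow between `t` and `t + 1` leaves the even one, so the homotopy runs forwards for even
    -- `t` and backwards for odd `t`.
    rcases Nat.even_or_odd t with ht | ht
    · refine Quot.sound (F.step_reparam k _ _ fun a => (hs t a).imp_right fun e => ?_)
      rw [e.1, e.2]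
      exact Or.inl ⟨rfl, ht⟩
    · refine (Quot.sound (F.step_reparam k _ _ fun a =>
        (hs t a).imp (fun e => e.symm) fun e => ?_)).symm
      rw [e.1, e.2]
      exact Or.inr ⟨rfl, ht⟩

end

end StableMap

/-! ### Digraph maps of the infinite line -/

theorem isLineMap_of_step {u : ℕ → ℕ}
    (h : ∀ a, u (a + 1) = u a ∨ (u (a + 1) = u a + 1 ∧ (Even (u a) ↔ Even a))) : IsLineMap u := by
  rintro a b (⟨rfl, ha⟩ | ⟨rfl, hb⟩)
  · rcases h a with e | ⟨e, e'⟩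
    · exact Or.inr e.symm
    · exact Or.inl (Or.inl ⟨e, e'.2 ha⟩)
  · rcases h b with e | ⟨e, e'⟩
    · exact Or.inr e
    · refine Or.inl (Or.inr ⟨e, ?_⟩)
      rw [← Nat.not_even_iff_odd] at hb ⊢
      exact fun h => hb (e'.1 h)

/-- At every step the maximum either pauses or copies an advance of a map attaining it, and so
inherits the parity condition. -/
theorem IsLineMap.sup_of_monotone {u w : ℕ → ℕ} (hu : IsLineMap u) (hw : IsLineMap w) (hum : Monotone u)
    (hwm : Monotone w) : IsLineMap fun a => max (u a) (w a) := by
  refine isLineMap_of_step fun a => ?_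
  rcases hu.step hum a with e | ⟨e, p⟩ <;> rcases hw.step hwm a with e' | ⟨e', p'⟩ <;>
    rw [e, e'] <;> rcases le_or_gt (u a) (w a) with h | h
  · exact Or.inl rfl
  · exact Or.inl rfl
  · rw [max_eq_right h]
    exact Or.inr ⟨by omega, p'⟩
  · exact Or.inl (by omega)
  · rcases h.lt_or_eq with h | h
    · exact Or.inl (by omega)
    · rw [← h, max_self]
      exact Or.inr ⟨by omega, p⟩
  · rw [max_eq_left h.le]
    exact Or.inr ⟨by omega, p⟩
  · rw [max_eq_right h]
    exact Or.inr ⟨by omega, p'⟩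
  · rw [max_eq_left h.le]
    exact Or.inr ⟨by omega, p⟩

theorem isLineMap_min (t : ℕ) : IsLineMap fun a => min a t := fun _ _ h => lineAdj_min t h

/-- An arrow with an end below `t` has both ends at most `t` and collapses. No monotonicity is
needed, so this applies to the distance to a point, used for inverses. -/
theorem IsLineMap.max_const {u : ℕ → ℕ} (hu : IsLineMap u) (t : ℕ) :
    IsLineMap fun a => max (u a) t := by
  intro a b hab
  rcases hu hab with (⟨h, e⟩ | ⟨h, e⟩) | h
  · rcases lt_or_ge (u a) t with h1 | h1
    · exact Or.inr (show max _ t = max _ t by omega)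
    · simp only [LineAdj]
      rw [max_eq_left h1, max_eq_left (by omega)]
      exact Or.inl (Or.inl ⟨h, e⟩)
  · rcases lt_or_ge (u b) t with h1 | h1
    · exact Or.inr (show max _ t = max _ t by omega)
    · simp only [LineAdj]
      rw [max_eq_left h1, max_eq_left (by omega)]
      exact Or.inl (Or.inr ⟨h, e⟩)
  · exact Or.inr (congrArg (max · t) h)

/-- Evenness of `c` preserves parities and hence the direction of arrows; the same holds for the
reflection and the distance function below. -/
theorem isLineMap_sub {c : ℕ} (hc : Even c) : IsLineMap fun a => a - c := by
  intro a b h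
  simp only [LineAdj, Nat.even_iff, Nat.odd_iff] at *
  omega

theorem isLineMap_rsub {c : ℕ} (hc : Even c) : IsLineMap fun a => c - a := by
  intro a b h
  simp only [LineAdj, Nat.even_iff, Nat.odd_iff] at *
  omega

theorem isLineMap_dist {c : ℕ} (hc : Even c) : IsLineMap fun a => (c - a) + (a - c) := by
  intro a b h
  simp only [LineAdj, Nat.even_iff, Nat.odd_iff] at *
  omega

namespace StableMap

section

variable {V : Type*} {P : BasedPair V} {n : ℕ} [NeZero n]

/-- Delaying in one coordinate does not change the homotopy class. -/
theorem exists_cls_reparam_eq (F : StableMap P n) (k : Fin n) {u : ℕ → ℕ} (hu : IsLineMap u)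
    (hm : Monotone u) (hle : ∀ a, u a ≤ a) {B : ℕ} (hB : ∀ v, B ≤ v k → F.toFun v = P.x₀)
    (hN : ∃ N, ∀ a, N ≤ a → B ≤ u a) :
    ∃ h : F.Admissible k u, cls (F.reparam k u h) = cls F := by
  obtain ⟨N, hN⟩ := hN
  -- This family starts at `u` for `t = 0`. At `t = B` it is the identity up to `B`, and beyond `B`
  -- its values are at least `B`, where `F` is `x₀`. From `t` to `t + 1` only values equal to `t`
  -- change.
  have hadm : ∀ t, F.Admissible k fun a => max (u a) (min a t) := fun t => by
    refine ⟨hu.sup_of_monotone (isLineMap_min t) hm fun _ _ h => min_le_min_right t h,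
      Or.inl ?_, N, fun a ha v hv => hB v ?_⟩
    · have := hle 0
      omega
    · exact (hN a ha).trans ((le_max_left _ _).trans hv.ge)
  have h0 : (fun a => max (u a) (min a 0)) = u := funext fun a => by simp
  have hadm0 : F.Admissible k u := h0 ▸ hadm 0
  refine ⟨hadm0, ?_⟩
  have h := F.cls_reparam_path k (fun t a => max (u a) (min a t)) hadm
    (fun t a => by have := hle a; omega) B
  have e0 : F.reparam k _ (hadm 0) = F.reparam k u hadm0 :=
    StableMap.ext (funext fun v => by simp [reparam])
  have e1 : F.reparam k _ (hadm B) = F := by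
    refine StableMap.ext (funext fun v => ?_)
    change F.toFun (Function.update v k (max (u (v k)) (min (v k) B))) = F.toFun v
    rcases le_total (v k) B with hv | hv
    · rw [min_eq_left hv, max_eq_right (hle _), Function.update_eq_self]
    · rw [hB v hv, hB]
      rw [Function.update_self, min_eq_right hv]
      exact le_max_right _ _
  rw [e0, e1] at h
  exact h

/-! ### Comparison with grid maps -/

/-- The stable map of a grid map. -/
noncomputable def ofGrid {m : Fin n → ℕ} (f : GridMap P m) : StableMap P n where
  toFun := f.extend
  isMap := f.isMap_extend
  mem := f.extend_mem
  mapsInto v w h hv hw := by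
    obtain ⟨k, hk, hne⟩ := h
    exact f.extend_mapsInto v w hv hw k hk hne
  zero v k hk hv := f.extend_horn v (Or.inr ⟨k, hk, hv⟩)
  bounded := ⟨Finset.univ.sup m, fun v k hk =>
    f.extend_horn v (Or.inl ⟨k, (Finset.le_sup (f := m) (Finset.mem_univ k)).trans hk⟩)⟩

/-- The restriction of a stable map to a sufficiently large grid. -/
def restrict (F : StableMap P n) (m : Fin n → ℕ) (hm : ∀ v k, m k ≤ v k → F.toFun v = P.x₀) :
    GridMap P m where
  toFun v := F.toFun fun k => v k
  isMap := by
    rintro v w ⟨k, hk, hne⟩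
    exact F.isMap ⟨k, hk, fun j hj => congrArg Fin.val (hne j hj)⟩
  boundary := by
    have key : ∀ (v : GridVertex m) (k), IsEnd (v k) →
        ((v 0 : ℕ) = 0 ∧ k = 0) ∨ F.toFun (fun k => v k) = P.x₀ := by
      rintro v k (hk | hk)
      · have hk' : (v k : ℕ) = 0 := congrArg Fin.val hk
        by_cases h0 : k = 0
        · subst h0; exact Or.inl ⟨hk', rfl⟩
        · exact Or.inr (F.zero _ k h0 hk')
      · exact Or.inr (hm _ k (congrArg Fin.val hk).ge)
    refine ⟨fun v ⟨k, hk⟩ => ?_, fun v w ⟨⟨j, hj, hne⟩, k, hk, e⟩ => ?_⟩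
    · rcases key v k hk with ⟨h, _⟩ | h
      · exact F.mem _ h
      · exact (congrArg (· ∈ P.A.verts) h).mpr P.mem
    · have hadj : (natGrid n).Adj (fun k => (v k : ℕ)) fun k => (w k : ℕ) :=
        ⟨j, hj, fun i hi => congrArg Fin.val (hne i hi)⟩
      rcases key v k hk with ⟨h, rfl⟩ | h
      · exact F.mapsInto _ _ hadj h ((congrArg Fin.val e).symm.trans h)
      · rcases key w k (e ▸ hk) with ⟨h', rfl⟩ | h'
        · exact F.mapsInto _ _ hadj ((congrArg Fin.val e).trans h') h'
        · exact Or.inr (h.trans h'.symm)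
  horn v hv := by
    rcases hv with hv | ⟨k, hk, hv | hv⟩
    · exact hm _ 0 (congrArg Fin.val hv).ge
    · exact F.zero _ k hk (congrArg Fin.val hv)
    · exact hm _ k (congrArg Fin.val hv).ge

theorem ofGrid_restrict (F : StableMap P n) (m : Fin n → ℕ)
    (hm : ∀ v k, m k ≤ v k → F.toFun v = P.x₀) : ofGrid (F.restrict m hm) = F := by
  refine StableMap.ext (funext fun v => ?_)
  change GridMap.extend _ v = _
  unfold GridMap.extend
  split_ifs with h
  · rfl
  · push Not at h
    obtain ⟨k, hk⟩ := h
    exact (hm v k hk.le).symm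

theorem restrict_ofGrid {m : Fin n → ℕ} (f : GridMap P m)
    (hm : ∀ v k, m k ≤ v k → (ofGrid f).toFun v = P.x₀) : (ofGrid f).restrict m hm = f := by
  cases f
  unfold restrict
  congr
  exact funext fun v => GridMap.extend_val _ v

theorem Step.directHomotopic {F G : StableMap P n} (h : Step F G) (m : Fin n → ℕ)
    (hF : ∀ v k, m k ≤ v k → F.toFun v = P.x₀) (hG : ∀ v k, m k ≤ v k → G.toFun v = P.x₀) :
    DirectHomotopic (F.restrict m hF) (G.restrict m hG) := by
  -- A boundary vertex lies in the horn, where both maps are `x₀`, or on the face `v 0 = 0`, where a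
  -- step moves along arrows of `A`.
  have hA : ∀ v : GridVertex m, v ∈ (gridBoundary m).verts →
      P.A.Adj ((F.restrict m hF).toFun v) ((G.restrict m hG).toFun v) ∨
        (F.restrict m hF).toFun v = (G.restrict m hG).toFun v := by
    rintro v ⟨k, hk⟩
    by_cases hv : v ∈ gridHorn m
    · exact Or.inr (((F.restrict m hF).horn v hv).trans ((G.restrict m hG).horn v hv).symm)
    · refine h.2 _ ?_
      by_cases h0 : k = 0
      · subst h0
        exact congrArg Fin.val (hk.resolve_right fun e => hv (Or.inl e))
      · exact absurd (Or.inr ⟨k, h0, hk⟩) hv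
  refine ⟨fun p => if p.2 = 0 then (F.restrict m hF).toFun p.1 else (G.restrict m hG).toFun p.1,
    ?_, ⟨?_, ?_⟩, ?_, fun v => rfl, fun v => rfl⟩
  · rintro ⟨v, s⟩ ⟨w, t⟩ (⟨e, hst⟩ | ⟨hvw, e⟩)
    · obtain ⟨rfl, rfl⟩ := eq_zero_one_of_lineAdj hst
      obtain rfl : v = w := e
      exact h.1 _
    · obtain rfl : s = t := e
      simp only
      split_ifs
      · exact (F.restrict m hF).isMap hvw
      · exact (G.restrict m hG).isMap hvw
  · rintro ⟨v, s⟩ hv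
    simp only
    split_ifs
    · exact (F.restrict m hF).boundary.1 v hv
    · exact (G.restrict m hG).boundary.1 v hv
  · rintro ⟨v, s⟩ ⟨w, t⟩ (⟨e, hv, hst⟩ | ⟨hvw, e⟩)
    · obtain ⟨rfl, rfl⟩ := eq_zero_one_of_lineAdj hst
      obtain rfl : v = w := e
      exact hA v hv
    · obtain rfl : s = t := e
      simp only
      split_ifs
      · exact (F.restrict m hF).boundary.2 hvw
      · exact (G.restrict m hG).boundary.2 hvw
  · intro v hv t
    simp only
    split_ifs
    · exact (F.restrict m hF).horn v hv
    · exact (G.restrict m hG).horn v hv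

theorem step_ofGrid {m : Fin n → ℕ} {f g : GridMap P m} (h : DirectHomotopic f g) :
    Step (ofGrid f) (ofGrid g) := by
  obtain ⟨F, hF, hA, -, h0, h1⟩ := h
  have hl : (line 1).Adj 0 1 := Or.inl ⟨rfl, Even.zero⟩
  refine ⟨fun v => ?_, fun v hv => ?_⟩
  · change P.G.Adj (f.extend v) (g.extend v) ∨ f.extend v = g.extend v
    rw [f.extend_eq_clamp, g.extend_eq_clamp, ← h0, ← h1]
    exact hF (Or.inl ⟨rfl, hl⟩)
  · change P.A.Adj (f.extend v) (g.extend v) ∨ f.extend v = g.extend v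
    rw [f.extend_eq_clamp, g.extend_eq_clamp, ← h0, ← h1]
    refine hA.2 (Or.inl ⟨rfl, ⟨0, Or.inl (Fin.ext ?_)⟩, hl⟩)
    change min (v 0) (m 0) = 0
    rw [hv, Nat.zero_min]

/-- A shrinking map starts at `0` and never advances by more than one, so it is a delay. The
coordinates are treated one at a time, `S` being the set of those already subdivided. -/
theorem cls_ofGrid_subdivide {m M : Fin n → ℕ} (f : GridMap P m) (h : Shrinking M m) :
    cls (ofGrid (f.subdivide h)) = cls (ofGrid f) := by
  have key : ∀ S : Finset (Fin n), ∃ G : StableMap P n,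
      (∀ v, G.toFun v = f.extend fun k => if k ∈ S then extendLine (h.toFun k) (v k) else v k) ∧
        cls G = cls (ofGrid f) := by
    intro S
    induction S using Finset.induction_on with
    | empty => exact ⟨ofGrid f, fun v => rfl, rfl⟩
    | insert k S hk ih =>
      obtain ⟨G, hG, e⟩ := ih
      have hs := h.shrinks k
      have hle : ∀ a, extendLine (h.toFun k) a ≤ a := by
        intro a
        induction a with
        | zero => exact hs.extendLine_zero.le
        | succ a ih =>
          have := hs.isLineMap.step hs.extendLine_monotone a
          omega
      have hB : ∀ v, m k ≤ v k → G.toFun v = P.x₀ := fun v hv => by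
        rw [hG]
        exact f.extend_horn _ (Or.inl ⟨k, by simpa [hk] using hv⟩)
      obtain ⟨ha, hc⟩ := G.exists_cls_reparam_eq k hs.isLineMap hs.extendLine_monotone hle hB
        ⟨M k, fun a ha => (hs.extendLine_of_ge ha).ge⟩
      refine ⟨_, fun v => ?_, hc.trans e⟩
      refine (hG _).trans (congrArg f.extend (funext fun j => ?_))
      by_cases hj : j = k
      · subst hj
        simp [hk]
      · simp [hj]
  obtain ⟨G, hG, e⟩ := key Finset.univ
  rw [← e]
  refine congrArg cls (StableMap.ext (funext fun v => ?_))
  refine (f.extend_subdivide h v).trans ?_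
  simp [hG]

end

end StableMap

/-! ### Restrictions to different grids and the bijection with stable classes -/

section

variable {V : Type*} {P : BasedPair V} {n : ℕ} [NeZero n]

theorem GridMap.ext_toFun {m : Fin n → ℕ} {f g : GridMap P m} (h : ∀ v, f.toFun v = g.toFun v) :
    f = g := by
  cases f
  cases g
  congr
  exact funext h

theorem DirectHomotopic.refl {m : Fin n → ℕ} (f : GridMap P m) : DirectHomotopic f f := by
  refine ⟨fun p => f.toFun p.1, ?_, ⟨fun p hp => f.boundary.1 _ hp, ?_⟩,
    fun v hv _ => f.horn v hv, fun v => rfl, fun v => rfl⟩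
  · rintro p q (⟨e, _⟩ | ⟨h, _⟩)
    · exact Or.inr (congrArg f.toFun e)
    · exact f.isMap h
  · rintro p q (⟨e, _⟩ | ⟨h, _⟩)
    · exact Or.inr (congrArg f.toFun e)
    · exact f.boundary.2 h

/-- The shrinking map which is the identity on the smaller grid and constant outside. -/
def Shrinking.ofLe {M m : Fin n → ℕ} (h : ∀ k, m k ≤ M k) : Shrinking M m where
  toFun k a := ⟨min a (m k), Nat.lt_succ_of_le (min_le_right _ _)⟩
  shrinks k :=
    { isMap := fun _ _ hab => (lineAdj_min (m k) hab).imp_right Fin.ext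
      map_zero := Fin.ext (Nat.zero_min _)
      map_last := Fin.ext (min_eq_right (h k))
      monotone := fun _ _ hab => Fin.mk_le_mk.2 (min_le_min_right _ hab) }

theorem DirectHomotopic.homotopySet_mk_eq {m : Fin n → ℕ} {f g : GridMap P m}
    (h : DirectHomotopic f g) : HomotopySet.mk f = HomotopySet.mk g := by
  have e : ∀ f : GridMap P m, f.subdivide (Shrinking.ofLe fun _ => le_rfl) = f := fun f =>
    GridMap.ext_toFun fun v => congrArg f.toFun (funext fun k =>
      Fin.ext (min_eq_left (Nat.le_of_lt_succ (v k).2)))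
  refine Quot.sound (.rel _ _ ⟨m, Shrinking.ofLe fun _ => le_rfl, Shrinking.ofLe fun _ => le_rfl, ?_⟩)
  rw [e, e]
  exact h

theorem HomotopySet.mk_subdivide {m M : Fin n → ℕ} (f : GridMap P m) (h : Shrinking M m) :
    HomotopySet.mk (f.subdivide h) = HomotopySet.mk f := by
  refine Quot.sound (.rel _ _ ⟨M, Shrinking.ofLe fun _ => le_rfl, h, ?_⟩)
  have e : (f.subdivide h).subdivide (Shrinking.ofLe fun _ => le_rfl) = f.subdivide h :=
    GridMap.ext_toFun fun v => congrArg (f.subdivide h).toFun (funext fun k =>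
      Fin.ext (min_eq_left (Nat.le_of_lt_succ (v k).2)))
  rw [e]
  exact DirectHomotopic.refl _

namespace StableMap

/-- The larger restriction is the subdivision of the smaller one along clamping, because `F` is `x₀`
on and beyond the far faces of the smaller grid. -/
theorem mk_restrict_eq_of_le (F : StableMap P n) {m M : Fin n → ℕ}
    (hm : ∀ v k, m k ≤ v k → F.toFun v = P.x₀) (hM : ∀ v k, M k ≤ v k → F.toFun v = P.x₀)
    (h : ∀ k, m k ≤ M k) :
    HomotopySet.mk (F.restrict M hM) = HomotopySet.mk (F.restrict m hm) := by
  rw [← HomotopySet.mk_subdivide (F.restrict m hm) (Shrinking.ofLe h)]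
  have e : F.restrict M hM = (F.restrict m hm).subdivide (Shrinking.ofLe h) := by
    refine GridMap.ext_toFun fun v => ?_
    change F.toFun (fun k => v k) = F.toFun fun k => min (v k) (m k)
    by_cases hv : ∀ k, (v k : ℕ) ≤ m k
    · exact congrArg F.toFun (funext fun k => (min_eq_left (hv k)).symm)
    · push Not at hv
      obtain ⟨k, hk⟩ := hv
      rw [hm _ k hk.le, hm _ k (min_eq_right hk.le).ge]
  rw [e]

theorem mk_restrict_eq (F : StableMap P n) {m M : Fin n → ℕ}
    (hm : ∀ v k, m k ≤ v k → F.toFun v = P.x₀) (hM : ∀ v k, M k ≤ v k → F.toFun v = P.x₀) :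
    HomotopySet.mk (F.restrict M hM) = HomotopySet.mk (F.restrict m hm) := by
  have h : ∀ v k, (max (m k) (M k)) ≤ v k → F.toFun v = P.x₀ := fun v k hk =>
    hm v k ((le_max_left _ _).trans hk)
  rw [← F.mk_restrict_eq_of_le hm h fun k => le_max_left _ _,
    ← F.mk_restrict_eq_of_le hM h fun k => le_max_right _ _]

theorem mk_restrict_ofGrid {m M : Fin n → ℕ} (f : GridMap P m)
    (hM : ∀ v k, M k ≤ v k → (ofGrid f).toFun v = P.x₀) :
    HomotopySet.mk ((ofGrid f).restrict M hM) = HomotopySet.mk f := by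
  have hm : ∀ v k, m k ≤ v k → (ofGrid f).toFun v = P.x₀ := fun v k hk =>
    f.extend_horn v (Or.inl ⟨k, hk⟩)
  rw [(ofGrid f).mk_restrict_eq hm hM, restrict_ofGrid]

/-- Homotopy classes of grid maps are homotopy classes of stable maps. -/
noncomputable def equivClasses : HomotopySet P n ≃ Classes P n where
  toFun := Quot.lift (fun f => cls (ofGrid f.2)) fun _ _ =>
    FHomotopic.eq_of_oneStep (fun f => cls (ofGrid f.2)) fun f g ⟨M, h, h', hd⟩ => by
      rw [← cls_ofGrid_subdivide f.2 h, ← cls_ofGrid_subdivide g.2 h']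
      exact Quot.sound (step_ofGrid hd)
  invFun := Quot.lift
    (fun F => HomotopySet.mk (F.restrict (fun _ => F.bounded.choose) F.bounded.choose_spec))
    fun F G h => by
      have hF : ∀ v (k : Fin n), max F.bounded.choose G.bounded.choose ≤ v k →
          F.toFun v = P.x₀ := fun v k hk => F.bounded.choose_spec v k ((le_max_left _ _).trans hk)
      have hG : ∀ v (k : Fin n), max F.bounded.choose G.bounded.choose ≤ v k →
          G.toFun v = P.x₀ := fun v k hk => G.bounded.choose_spec v k ((le_max_right _ _).trans hk)
      rw [F.mk_restrict_eq (m := fun _ => max F.bounded.choose G.bounded.choose) hF,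
        G.mk_restrict_eq (m := fun _ => max F.bounded.choose G.bounded.choose) hG]
      exact (h.directHomotopic _ hF hG).homotopySet_mk_eq
  left_inv x := by
    obtain ⟨m, f, rfl⟩ := x.exists_rep
    exact mk_restrict_ofGrid f _
  right_inv x := by
    obtain ⟨F, rfl⟩ := Quot.exists_rep x
    exact congrArg cls (F.ofGrid_restrict _ fun v k => F.bounded.choose_spec v k)

theorem equivClasses_mk {m : Fin n → ℕ} (f : GridMap P m) :
    equivClasses (HomotopySet.mk f) = cls (ofGrid f) := rfl

end StableMap

end

/-! ### The group structure -/

namespace StableMap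

section

variable {V : Type*} {P : BasedPair V} {n : ℕ}

/-- The function which is `φ` up to the hyperplane `v 1 = c`, followed by `ψ`. -/
def join {n : ℕ} (c : ℕ) (φ ψ : (Fin (n + 2) → ℕ) → V) (v : Fin (n + 2) → ℕ) : V :=
  if v 1 ≤ c then φ v else ψ (shift c v)

/-- On the seam `v 1 = c` both formulas give `x₀`. Since no arrow crosses the seam (`le_or_ge`),
each arrow can be checked with one formula only. -/
theorem join_of_ge {F : StableMap P (n + 2)} {c : ℕ} (hF : ∀ v, c ≤ v 1 → F.toFun v = P.x₀)
    (G : StableMap P (n + 2)) {v : Fin (n + 2) → ℕ} (hv : c ≤ v 1) :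
    join c F.toFun G.toFun v = G.toFun (shift c v) := by
  unfold join
  split_ifs with h
  · rw [hF v hv, G.zero _ 1 (by simp)]
    simp only [shift, if_true]
    omega
  · rfl

/-- Concatenation along the second coordinate at an even position `c`. -/
def concat (F : StableMap P (n + 2)) (c : ℕ) (hc : Even c)
    (hF : ∀ v, c ≤ v 1 → F.toFun v = P.x₀) (G : StableMap P (n + 2)) : StableMap P (n + 2) where
  toFun := join c F.toFun G.toFun
  isMap := by
    rintro v w ⟨k, hk, hne⟩
    rcases le_or_ge c hk hne with ⟨h1, h2⟩ | ⟨h1, h2⟩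
    · simp only [join, if_pos h1, if_pos h2]
      exact F.isMap ⟨k, hk, hne⟩
    · rw [join_of_ge hF G h1, join_of_ge hF G h2]
      exact G.isMap ⟨k, shift_adj hc h1 h2 hk hne⟩
  mem v hv := by
    unfold join
    split_ifs
    · exact F.mem v hv
    · exact G.mem _ (by simpa [shift] using hv)
  mapsInto := by
    rintro v w ⟨k, hk, hne⟩ hv hw
    rcases le_or_ge c hk hne with ⟨h1, h2⟩ | ⟨h1, h2⟩
    · simp only [join, if_pos h1, if_pos h2]
      exact F.mapsInto _ _ ⟨k, hk, hne⟩ hv hw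
    · rw [join_of_ge hF G h1, join_of_ge hF G h2]
      exact G.mapsInto _ _ ⟨k, shift_adj hc h1 h2 hk hne⟩ (by simpa [shift] using hv)
        (by simpa [shift] using hw)
  zero v k hk hv := by
    unfold join
    split_ifs
    · exact F.zero v k hk hv
    · refine G.zero _ k hk ?_
      unfold shift
      split_ifs <;> omega
  bounded := by
    obtain ⟨A, hA⟩ := F.bounded
    obtain ⟨B, hB⟩ := G.bounded
    refine ⟨c + A + B, fun v k hk => ?_⟩
    unfold join
    split_ifs
    · exact hA v k (by omega)
    · refine hB _ k ?_
      unfold shift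
      split_ifs <;> omega

theorem step_concat_right (F : StableMap P (n + 2)) {c : ℕ} (hc : Even c)
    (hF : ∀ v, c ≤ v 1 → F.toFun v = P.x₀) {G G' : StableMap P (n + 2)} (h : Step G G') :
    Step (F.concat c hc hF G) (F.concat c hc hF G') := by
  refine ⟨fun v => ?_, fun v hv => ?_⟩
  · by_cases h1 : v 1 ≤ c
    · exact Or.inr (by simp only [concat, join, if_pos h1])
    · simpa only [concat, join, if_neg h1] using h.1 (shift c v)
  · by_cases h1 : v 1 ≤ c
    · exact Or.inr (by simp only [concat, join, if_pos h1])
    · simpa only [concat, join, if_neg h1] using h.2 (shift c v) (by simpa [shift] using hv)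

theorem step_concat_left {F F' : StableMap P (n + 2)} {c : ℕ} (hc : Even c)
    (hF : ∀ v, c ≤ v 1 → F.toFun v = P.x₀) (hF' : ∀ v, c ≤ v 1 → F'.toFun v = P.x₀)
    (G : StableMap P (n + 2)) (h : Step F F') :
    Step (F.concat c hc hF G) (F'.concat c hc hF' G) := by
  refine ⟨fun v => ?_, fun v hv => ?_⟩
  · by_cases h1 : v 1 ≤ c
    · simpa only [concat, join, if_pos h1] using h.1 v
    · exact Or.inr (by simp only [concat, join, if_neg h1])
  · by_cases h1 : v 1 ≤ c
    · simpa only [concat, join, if_pos h1] using h.2 v hv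
    · exact Or.inr (by simp only [concat, join, if_neg h1])

theorem cls_concat_congr_right (F : StableMap P (n + 2)) {c : ℕ} (hc : Even c)
    (hF : ∀ v, c ≤ v 1 → F.toFun v = P.x₀) {G G' : StableMap P (n + 2)} (h : cls G = cls G') :
    cls (F.concat c hc hF G) = cls (F.concat c hc hF G') :=
  congrArg (Quot.map (F.concat c hc hF) fun _ _ => F.step_concat_right hc hF) h

theorem shift_eq_update (c : ℕ) (v : Fin (n + 2) → ℕ) :
    shift c v = Function.update v 1 (v 1 - c) := by
  funext k
  by_cases hk : k = 1
  · subst hk; simp [shift]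
  · simp [shift, hk]

/-- Cutting later means inserting a stretch of `x₀` before `G`, that is, delaying `G` by the even
number `c' - c`. -/
theorem cls_concat_of_le (F G : StableMap P (n + 2)) {c c' : ℕ} (hc : Even c) (hc' : Even c')
    (hF : ∀ v, c ≤ v 1 → F.toFun v = P.x₀) (hF' : ∀ v, c' ≤ v 1 → F.toFun v = P.x₀)
    (h : c ≤ c') : cls (F.concat c' hc' hF' G) = cls (F.concat c hc hF G) := by
  obtain ⟨B, hB⟩ := G.bounded
  obtain ⟨ha, e⟩ := G.exists_cls_reparam_eq 1 (u := fun a => a - (c' - c))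
    (isLineMap_sub ((Nat.even_sub h).2 (iff_of_true hc' hc)))
    (fun _ _ h => Nat.sub_le_sub_right h _) (fun a => Nat.sub_le _ _) (fun v => hB v 1)
    ⟨B + (c' - c), fun a ha => by omega⟩
  rw [← F.cls_concat_congr_right hc hF e]
  refine congrArg cls (StableMap.ext (funext fun v => ?_))
  simp only [concat, join, reparam]
  split_ifs with h1 h2 h2
  · rfl
  · rw [hF v (by omega), G.zero _ 1 (by simp)]
    simp only [shift, if_true, Function.update_self]
    omega
  · omega
  · refine congrArg G.toFun (funext fun k => ?_)
    by_cases hk : k = 1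
    · subst hk
      simp only [shift, if_true, Function.update_self]
      omega
    · simp [shift, hk]

theorem cls_concat_eq (F G : StableMap P (n + 2)) {c c' : ℕ} (hc : Even c) (hc' : Even c')
    (hF : ∀ v, c ≤ v 1 → F.toFun v = P.x₀) (hF' : ∀ v, c' ≤ v 1 → F.toFun v = P.x₀) :
    cls (F.concat c hc hF G) = cls (F.concat c' hc' hF' G) := by
  rcases le_total c c' with h | h
  · exact (F.cls_concat_of_le G hc hc' hF hF' h).symm
  · exact F.cls_concat_of_le G hc' hc hF' hF h

/-- The product of a stable map with a stable map. -/
noncomputable def mulClass (F G : StableMap P (n + 2)) : Classes P (n + 2) :=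
  cls (F.concat (2 * F.bounded.choose) (even_two_mul _)
    (fun v hv => F.bounded.choose_spec v 1 (by omega)) G)

theorem mulClass_eq (F G : StableMap P (n + 2)) {c : ℕ} (hc : Even c)
    (hF : ∀ v, c ≤ v 1 → F.toFun v = P.x₀) : F.mulClass G = cls (F.concat c hc hF G) :=
  F.cls_concat_eq G _ hc _ hF

noncomputable instance : Mul (Classes P (n + 2)) where
  mul := Quot.lift₂ mulClass
    (fun F _ _ h => Quot.sound (F.step_concat_right _ _ h))
    fun F F' G h => by
      -- A homotopy of first factors passes to the products only when both are cut at the same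
      -- position; doubling the larger bound makes it even.
      have hF : ∀ v : Fin (n + 2) → ℕ, 2 * max F.bounded.choose F'.bounded.choose ≤ v 1 →
          F.toFun v = P.x₀ := fun v hv => F.bounded.choose_spec v 1 (by omega)
      have hF' : ∀ v : Fin (n + 2) → ℕ, 2 * max F.bounded.choose F'.bounded.choose ≤ v 1 →
          F'.toFun v = P.x₀ := fun v hv => F'.bounded.choose_spec v 1 (by omega)
      rw [F.mulClass_eq G (even_two_mul _) hF, F'.mulClass_eq G (even_two_mul _) hF']
      exact Quot.sound (step_concat_left _ _ _ G h)

theorem cls_mul (F G : StableMap P (n + 2)) {c : ℕ} (hc : Even c)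
    (hF : ∀ v, c ≤ v 1 → F.toFun v = P.x₀) : cls F * cls G = cls (F.concat c hc hF G) :=
  F.mulClass_eq G hc hF

theorem exists_even_bound (F : StableMap P (n + 2)) :
    ∃ c, Even c ∧ ∀ v k, c ≤ v k → F.toFun v = P.x₀ := by
  obtain ⟨N, hN⟩ := F.bounded
  exact ⟨2 * N, even_two_mul N, fun v k h => hN v k (by omega)⟩

/-- The constant stable map. -/
def const (P : BasedPair V) (n : ℕ) [NeZero n] : StableMap P n where
  toFun _ := P.x₀
  isMap _ _ _ := Or.inr rfl
  mem _ _ := P.mem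
  mapsInto _ _ _ _ _ := Or.inr rfl
  zero _ _ _ _ := rfl
  bounded := ⟨0, fun _ _ _ => rfl⟩

/-- With `F` cut at `c`, `G` at `d` and their product at `c + d`, the two bracketings are the same
function; no homotopy is needed. -/
theorem cls_mul_assoc (x y z : Classes P (n + 2)) : x * y * z = x * (y * z) := by
  obtain ⟨F, rfl⟩ := Quot.exists_rep x
  obtain ⟨G, rfl⟩ := Quot.exists_rep y
  obtain ⟨H, rfl⟩ := Quot.exists_rep z
  obtain ⟨c, hc, hF⟩ := F.exists_even_bound
  obtain ⟨d, hd, hG⟩ := G.exists_even_bound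
  have hFG : ∀ v, c + d ≤ v 1 → (F.concat c hc (fun v => hF v 1) G).toFun v = P.x₀ := by
    intro v hv
    simp only [concat, join]
    split_ifs
    · exact hF v 1 (by omega)
    · refine hG _ 1 ?_
      simp only [shift, if_true]
      omega
  rw [cls_mul F G hc fun v => hF v 1, cls_mul G H hd fun v => hG v 1,
    cls_mul _ H (hc.add hd) hFG, cls_mul F _ hc fun v => hF v 1]
  refine congrArg cls (StableMap.ext (funext fun v => ?_))
  have h1 : shift c v 1 = v 1 - c := by simp [shift]
  simp only [concat, join, h1]
  split_ifs <;> first | rfl | omega | skip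
  refine congrArg H.toFun (funext fun k => ?_)
  unfold shift
  split_ifs <;> omega

theorem cls_const_mul (x : Classes P (n + 2)) : cls (const P (n + 2)) * x = x := by
  obtain ⟨F, rfl⟩ := Quot.exists_rep x
  rw [cls_mul (const P (n + 2)) F Even.zero fun _ _ => rfl]
  refine congrArg cls (StableMap.ext (funext fun v => ?_))
  simp only [concat, join]
  split_ifs with h
  · exact (F.zero v 1 (by simp) (by omega)).symm
  · refine congrArg F.toFun (funext fun k => ?_)
    unfold shift
    split_ifs <;> rfl

/-- The reverse of `F` followed by `F` is `F` reparametrized by the distance to `c` in the second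
coordinate. It is contracted by raising a floor under this distance. -/
theorem exists_cls_mul_eq_const (x : Classes P (n + 2)) : ∃ y, y * x = cls (const P (n + 2)) := by
  obtain ⟨F, rfl⟩ := Quot.exists_rep x
  obtain ⟨c, hc, hF⟩ := F.exists_even_bound
  have h10 : (1 : Fin (n + 2)) ≠ 0 := by simp
  have hrev : F.Admissible 1 fun a => c - a :=
    ⟨isLineMap_rsub hc, Or.inr ⟨h10, fun v hv => hF v 1 hv.ge⟩,
      c, fun a ha v hv => F.zero v 1 h10 (by omega)⟩
  have hb : ∀ v, c ≤ v 1 → (F.reparam 1 _ hrev).toFun v = P.x₀ := fun v hv =>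
    F.zero _ 1 h10 ((Function.update_self ..).trans (Nat.sub_eq_zero_of_le hv))
  -- With truncated subtraction the sum is `|a - c|`. The floor `t = 0` gives the product, and `t =
  -- c` leaves only values where `F` is `x₀`. The distance is at least `c` from `2 * c` on.
  have hadm : ∀ t, F.Admissible 1 fun a => max ((c - a) + (a - c)) t := fun t =>
    ⟨(isLineMap_dist hc).max_const t, Or.inr ⟨h10, fun v hv => hF v 1 (by omega)⟩,
      2 * c, fun a ha v hv => hF v 1 (by omega)⟩
  have h := F.cls_reparam_path 1 (fun t a => max ((c - a) + (a - c)) t) hadm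
    (fun t a => by omega) c
  refine ⟨cls (F.reparam 1 _ hrev), (cls_mul _ F hc hb).trans ?_⟩
  have e0 : (F.reparam 1 _ hrev).concat c hc hb F = F.reparam 1 _ (hadm 0) := by
    refine StableMap.ext (funext fun v => ?_)
    simp only [concat, join, reparam, shift_eq_update, Nat.max_zero]
    split_ifs with h
    · rw [Nat.sub_eq_zero_of_le h, add_zero]
    · rw [Nat.sub_eq_zero_of_le (by omega : c ≤ v 1), zero_add]
  have e1 : F.reparam 1 _ (hadm c) = const P (n + 2) :=
    StableMap.ext (funext fun v => hF _ 1 (by rw [Function.update_self]; exact le_max_right _ _))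
  rw [e0, h, e1]

noncomputable instance : One (Classes P (n + 2)) := ⟨cls (const P (n + 2))⟩

noncomputable instance : Inv (Classes P (n + 2)) := ⟨fun x => (exists_cls_mul_eq_const x).choose⟩

noncomputable instance : Group (Classes P (n + 2)) :=
  Group.ofLeftAxioms cls_mul_assoc cls_const_mul fun x => (exists_cls_mul_eq_const x).choose_spec

theorem ofGrid_concat {m l : Fin (n + 2) → ℕ} (f : GridMap P m) (g : GridMap P l)
    (hm : Even (m 1)) : ofGrid (f.concat g hm) =
      (ofGrid f).concat (m 1) hm (fun v hv => f.extend_horn v (Or.inl ⟨1, hv⟩)) (ofGrid g) := by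
  refine StableMap.ext (funext fun v => ?_)
  change GridMap.extend _ v = concatFun f g v
  unfold GridMap.extend
  split_ifs with h
  · rfl
  · push Not at h
    obtain ⟨k, hk⟩ := h
    exact (concatFun_horn f g v (Or.inl ⟨k, hk.le⟩)).symm

end

end StableMap

/-- Concatenation makes the homotopy sets of dimension at least two groups. -/
noncomputable abbrev homotopyGroup {V : Type*} (P : BasedPair V) (n : ℕ) :
    Group (HomotopySet P (n + 2)) :=
  StableMap.equivClasses.group

theorem homotopyGroup_mul {V : Type*} {P : BasedPair V} {n : ℕ} {m l : Fin (n + 2) → ℕ}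
    (f : GridMap P m) (g : GridMap P l) (hm : Even (m 1)) :
    (homotopyGroup P n).mul (HomotopySet.mk f) (HomotopySet.mk g) =
      HomotopySet.mk (f.concat g hm) := by
  refine StableMap.equivClasses.injective ?_
  change StableMap.equivClasses (StableMap.equivClasses.symm
    (StableMap.cls (StableMap.ofGrid f) * StableMap.cls (StableMap.ofGrid g))) = _
  rw [Equiv.apply_symm_apply, StableMap.equivClasses_mk, StableMap.ofGrid_concat]
  exact StableMap.cls_mul _ _ _ _

/-! ### Additivity of the Hurewicz map -/

section

variable (R : Type*) [CommRing R] {V : Type*} {P : BasedPair V} {n : ℕ}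

/-- The equal sizes make the box of the concatenation the union of two boxes of side `N`, separated
by the seam, so the identity holds for chains and not merely up to homology. -/
theorem chain_concat {N : ℕ} (hN : Even N) (f g : GridMap P fun _ : Fin (n + 2) => N) :
    (f.concat g hN).chain R = f.chain R + g.chain R := by
  have hφ : IsMap (natGrid (n + 2)) P.G (concatFun f g) := fun _ _ ⟨k, hk, hne⟩ =>
    concatFun_isMap f g hN _ _ k hk hne
  rw [chain_eq_extend R f, chain_eq_extend R g, chain_eq_boxChain R (f.concat g hN) hφ
    fun v => rfl, ← map_add]
  refine congrArg _ ?_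
  unfold boxChain
  rw [← Finset.sum_filter_add_sum_filter_not _ fun i : Fin (n + 2) → ℕ => i 1 < N]
  have hsize : ∀ k, k ≠ 1 → concatSize (fun _ : Fin (n + 2) => N) (fun _ => N) k = N :=
    fun k hk => by simp [concatSize, hk]
  have hsize1 : concatSize (fun _ : Fin (n + 2) => N) (fun _ => N) 1 = N + N := by
    simp [concatSize]
  refine congrArg₂ (· + ·) ?_ ?_
  · refine Finset.sum_congr (Finset.ext fun i => ?_) fun i hi => ?_
    · rw [Finset.mem_filter, mem_box, mem_box]
      refine ⟨fun h k => ?_, fun h => ⟨fun k => ?_, h 1⟩⟩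
      · by_cases hk : k = 1
        · subst hk; exact h.2
        · exact hsize k hk ▸ h.1 k
      · by_cases hk : k = 1
        · subst hk; rw [hsize1]; exact (h 1).trans_le (by omega)
        · rw [hsize k hk]; exact h k
    · have e : cubeOf hφ i = cubeOf f.isMap_extend i :=
        Subtype.ext (funext fun x => if_pos (unitCube_le (mem_box.1 hi) x 1))
      rw [e]
  -- The cubes beyond the seam are those of `g` translated by `N`; as `N` is even, orientations and
  -- signs are unchanged.
  · refine Finset.sum_bij' (fun i _ => Function.update i 1 (i 1 - N))
      (fun i _ => Function.update i 1 (i 1 + N)) ?_ ?_ ?_ ?_ ?_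
    · intro i hi
      obtain ⟨h, h1⟩ := Finset.mem_filter.1 hi
      rw [mem_box] at h ⊢
      intro k
      by_cases hk : k = 1
      · subst hk
        have := h 1
        rw [hsize1] at this
        rw [Function.update_self]
        omega
      · rw [Function.update_of_ne hk]
        exact hsize k hk ▸ h k
    · intro i hi
      rw [mem_box] at hi
      rw [Finset.mem_filter, mem_box]
      refine ⟨fun k => ?_, by simp⟩
      by_cases hk : k = 1
      · subst hk
        have := hi 1
        rw [Function.update_self, hsize1]
        omega
      · rw [Function.update_of_ne hk, hsize k hk]
        exact hi k
    · intro i hi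
      have := (Finset.mem_filter.1 hi).2
      rw [Function.update_self, Function.update_idem, Nat.sub_add_cancel (by omega),
        Function.update_eq_self]
    · intro i hi
      rw [Function.update_self, Function.update_idem, Nat.add_sub_cancel, Function.update_eq_self]
    · intro i hi
      have hi1 : N ≤ i 1 := not_lt.1 (Finset.mem_filter.1 hi).2
      have hp : ∀ k, Even (i k) ↔ Even (Function.update i 1 (i 1 - N) k) := by
        intro k
        by_cases hk : k = 1
        · subst hk
          rw [Function.update_self, Nat.even_sub hi1]
          simp [hN]
        · rw [Function.update_of_ne hk]
      have e : cubeOf hφ i = cubeOf g.isMap_extend (Function.update i 1 (i 1 - N)) := by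
        refine Subtype.ext (funext fun x => ?_)
        refine (concatFun_of_ge f g _ ?_).trans (congrArg g.extend (funext fun k => ?_))
        · unfold unitCube
          split_ifs <;> omega
        · by_cases hk : k = 1
          · subst hk
            have hp1 := hp 1
            rw [Function.update_self] at hp1
            simp only [shift, if_true, unitCube, hp1, Function.update_self]
            split_ifs <;> omega
          · simp only [shift, hk, if_false, unitCube, Function.update_of_ne hk]
      have e' : (-1 : R) ^ (∑ k, i k) = (-1) ^ ∑ k, Function.update i 1 (i 1 - N) k := by
        rw [← Finset.prod_pow_eq_pow_sum, ← Finset.prod_pow_eq_pow_sum]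
        exact Finset.prod_congr rfl fun k _ => neg_one_pow_congr (hp k)
      rw [e, e']

/-- Stable maps can be restricted to any sufficiently large grid without changing the class, so `A +
B`, the sum of two even bounds, serves both as the common side and as an admissible position of the
seam. -/
theorem HomotopySet.exists_common_rep (x y : HomotopySet P (n + 2)) :
    ∃ N, Even N ∧ ∃ f g : GridMap P fun _ : Fin (n + 2) => N,
      HomotopySet.mk f = x ∧ HomotopySet.mk g = y := by
  obtain ⟨m, f, rfl⟩ := x.exists_rep
  obtain ⟨l, g, rfl⟩ := y.exists_rep
  obtain ⟨A, hA, hf⟩ := (StableMap.ofGrid f).exists_even_bound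
  obtain ⟨B, hB, hg⟩ := (StableMap.ofGrid g).exists_even_bound
  exact ⟨A + B, hA.add hB,
    (StableMap.ofGrid f).restrict _ fun v k h => hf v k (by omega),
    (StableMap.ofGrid g).restrict _ fun v k h => hg v k (by omega),
    StableMap.mk_restrict_ofGrid f _, StableMap.mk_restrict_ofGrid g _⟩

theorem relHurewicz_mul (x y : HomotopySet P (n + 2)) :
    relHurewicz R P (n + 1) ((homotopyGroup P n).mul x y) =
      relHurewicz R P (n + 1) x + relHurewicz R P (n + 1) y := by
  obtain ⟨N, hN, f, g, rfl, rfl⟩ := HomotopySet.exists_common_rep x y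
  rw [homotopyGroup_mul f g hN]
  refine congrArg Submodule.Quotient.mk (Subtype.ext ?_)
  exact (congrArg (QuotTerm.mk (incl R P.A) (n + 2)) (chain_concat R hN f g)).trans (map_add _ _ _)

end

end DigraphHurewicz

/-! ### The Hurewicz theorem for digraph pairs -/

open DigraphHurewicz in
theorem theorem4p2 {R : Type*} [CommRing R] {V W : Type*} (P : BasedPair V) (Q : BasedPair W)
    (φ : P.Hom Q) :
    -- the relative chain `h_n(f)` is invariant under subdivision
    (∀ (n : ℕ) (m M : Fin (n + 1) → ℕ) (f : GridMap P m) (h : Shrinking M m),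
      (f.subdivide h).relChain R = f.relChain R) ∧
    -- the Hurewicz maps for the pairs `(G, A)` and `(H, B)` and for the digraph `A`, in degrees `≥ 1`
    ∃ (HP : ∀ n : ℕ, HomotopySet P (n + 1) → RelHomology R P.A (n + 1))
      (HQ : ∀ n : ℕ, HomotopySet Q (n + 1) → RelHomology R Q.A (n + 1))
      (HA : ∀ n : ℕ, HomotopySet P.sub (n + 1) → CubicalHomology R P.A.coe (n + 1)),
      -- `h_n(f)` is a cycle, and the class `[f]` is sent to the homology class of `h_n(f)`
      (∀ (n : ℕ) (m : Fin (n + 1) → ℕ) (f : GridMap P m),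
        ∃ hz : outgoing (relBd R P.A) (n + 1) (f.relChain R) = 0,
          HP n (HomotopySet.mk f) = Homology.mk (relBd R P.A) (n + 1) (f.relChain R) hz) ∧
      (∀ (n : ℕ) (m : Fin (n + 1) → ℕ) (f : GridMap Q m),
        ∃ hz : outgoing (relBd R Q.A) (n + 1) (f.relChain R) = 0,
          HQ n (HomotopySet.mk f) = Homology.mk (relBd R Q.A) (n + 1) (f.relChain R) hz) ∧
      (∀ (n : ℕ) (m : Fin (n + 1) → ℕ) (f : GridMap P.sub m),
        ∃ hz : outgoing (nbd R P.A.coe) (n + 1) (f.chain R) = 0,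
          HA n (HomotopySet.mk f) = Homology.mk (nbd R P.A.coe) (n + 1) (f.chain R) hz) ∧
      -- in degrees `≥ 2` concatenation makes the homotopy set a group, and the Hurewicz map is a
      -- group homomorphism
      (∀ n : ℕ, ∃ _ : Group (HomotopySet P (n + 2)),
        (∀ (m l : Fin (n + 2) → ℕ) (f : GridMap P m) (g : GridMap P l) (hm : Even (m 1)),
          HomotopySet.mk f * HomotopySet.mk g = HomotopySet.mk (f.concat g hm)) ∧
        ∀ x y : HomotopySet P (n + 2), HP (n + 1) (x * y) = HP (n + 1) x + HP (n + 1) y) ∧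
      -- naturality in based maps of pairs
      (∀ (n : ℕ) (x : HomotopySet P (n + 1)),
        relHomologyMap R φ (n + 1) (HP n x) = HQ n (HomotopySet.map φ (n + 1) x)) ∧
      -- compatibility with the boundary maps
      (∀ (n : ℕ) (x : HomotopySet P (n + 2)),
        relConnecting R P.A (n + 1) (HP (n + 1) x) = -HA n (HomotopySet.boundary P n x)) := by
  refine ⟨fun n m M f h => congrArg (QuotTerm.mk (incl R P.A) (n + 1)) (chain_subdivide R f h),
    relHurewicz R P, relHurewicz R Q, absHurewicz R P,
    fun n m f => ⟨relBd_relChain R f, rfl⟩, fun n m f => ⟨relBd_relChain R f, rfl⟩,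
    fun n m f => ⟨nbd_chain_sub R f, rfl⟩,
    fun n => ⟨homotopyGroup P n, fun m l f g hm => homotopyGroup_mul f g hm, relHurewicz_mul R⟩,
    fun n x => relHomologyMap_relHurewicz R φ x, fun n x => relConnecting_relHurewicz R x⟩
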